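/- Let $Y\subset\wedge^3\mathbb C^6$ be the $GL_6$-stable closed subvariety of partially decomposable three-forms, $Y=\{v\wedge\omega : v\in\mathbb C^6,\ \omega\in\wedge^2\mathbb C^6\}$. For a vector bundle $E$ of rank six on a complex scheme $X$ and a section $s$ of $\wedge^3E$, let $D_Y(s)\subset X$ be the closed subscheme obtained as the scheme-theoretic preimage, under $s\colon X\to\wedge^3E$, of the subbundle of $\wedge^3 E$ with fibre $Y$: in a local frame of $E$ it is defined by the equations $f(s)=0$, where $f$ runs over the polynomials vanishing on $Y$. For a section $t$ of a vector bundle, let $\mathscr Z(t)$ be its scheme-theoretic zero locus. A property holds for a general section of a bundle if it holds for all sections in some non-empty Zariski open subset of the space of global sections. Proposition. Let $X$ be an integral proper scheme over $\mathbb C$ (for instance a smooth projective variety), let $L$ be a globally generated line bundle on $X$, and let $E=L\oplus 5\mathcal O_X$ (where $5F$ denotes $F^{\oplus 5}$). Then, for a general section $s$ of $\wedge^3E$, the degeneracy locus $D_Y(s)$ is the zero locus of a general section of $5L$. Precisely, there is a map $T\colon H^0(X,\wedge^3E)\to H^0(X,5L)$ such that $D_Y(s)=\mathscr Z(T(s))$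 as closed subschemes of $X$ for general $s$, and such that every property that holds for a general section of $5L$ holds for $T(s)$ for general $s$. -/

import Mathlib

open CategoryTheory CategoryTheory.Limits AlgebraicGeometry Opposite

noncomputable section

/-! ### Exterior powers of sheaves of modules -/

/-- The map `⋀ⁿ M → ⋀ⁿ N`, `m₁ ∧ … ∧ mₙ ↦ f m₁ ∧ … ∧ f mₙ`, induced by a map `f : M → N` that is
semilinear along a homomorphism of commutative rings `σ : R → S`. -/
def exteriorPowerMapSemilinear {R S : Type*} [CommRing R] [CommRing S] {σ : R →+* S}
    {M N : Type*} [AddCommGroup M] [Module R M] [AddCommGroup N] [Module S N]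
    (f : M →ₛₗ[σ] N) (n : ℕ) : ⋀[R]^n M →ₛₗ[σ] ⋀[S]^n N :=
  letI : Module R (⋀[S]^n N) := Module.compHom _ σ
  let g : M [⋀^Fin n]→ₗ[R] ⋀[S]^n N :=
    { toFun := fun m => exteriorPower.ιMulti S n (fun i => f (m i))
      map_update_add' := by
        intro _ m i x y
        have h (z : M) : (fun j => f (Function.update m i z j)) =
            Function.update (fun j => f (m j)) i (f z) := by
          ext j; by_cases hj : j = i
          · subst hj; simp
          · simp [hj]
        have e : ‹DecidableEq (Fin n)› = instDecidableEqFin n := Subsingleton.elim _ _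
        subst e
        rw [h, h, h, map_add, AlternatingMap.map_update_add]
      map_update_smul' := by
        intro _ m i c x
        have h (z : M) : (fun j => f (Function.update m i z j)) =
            Function.update (fun j => f (m j)) i (f z) := by
          ext j; by_cases hj : j = i
          · subst hj; simp
          · simp [hj]
        have e : ‹DecidableEq (Fin n)› = instDecidableEqFin n := Subsingleton.elim _ _
        subst e
        rw [h, h, map_smulₛₗ, AlternatingMap.map_update_smul]
        rfl
      map_eq_zero_of_eq' := by
        intro m i j hij hne
        exact AlternatingMap.map_eq_zero_of_eq _ _ (by simp [hij]) hne }
  { toFun := exteriorPower.alternatingMapLinearEquiv g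
    map_add' := fun x y => map_add _ x y
    map_smul' := fun r x => map_smul (exteriorPower.alternatingMapLinearEquiv g) r x }

theorem exteriorPowerMapSemilinear_ιMulti {R S : Type*} [CommRing R] [CommRing S] {σ : R →+* S}
    {M N : Type*} [AddCommGroup M] [Module R M] [AddCommGroup N] [Module S N]
    (f : M →ₛₗ[σ] N) (n : ℕ) (m : Fin n → M) :
    exteriorPowerMapSemilinear f n (exteriorPower.ιMulti R n m) =
      exteriorPower.ιMulti S n (fun i => f (m i)) := by
  let _ : Module R (⋀[S]^n N) := Module.compHom _ σ
  exact exteriorPower.alternatingMapLinearEquiv_apply_ιMulti _ _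

/-- Two additive maps out of `⋀ⁿ M` that are semilinear along the same ring homomorphism agree
as soon as they agree on the products `m₁ ∧ … ∧ mₙ`. -/
theorem exteriorPower_semilinear_ext {R S : Type*} [CommRing R] [CommRing S] {σ : R →+* S}
    {M P : Type*} [AddCommGroup M] [Module R M] [AddCommGroup P] [Module S P] {n : ℕ}
    (f g : ⋀[R]^n M →ₛₗ[σ] P)
    (h : ∀ m : Fin n → M, f (exteriorPower.ιMulti R n m) = g (exteriorPower.ιMulti R n m))
    (x : ⋀[R]^n M) : f x = g x := by
  have hx : x ∈ Submodule.span R (Set.range (exteriorPower.ιMulti R n (M := M))) := by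
    rw [exteriorPower.ιMulti_span]; trivial
  induction hx using Submodule.span_induction with
  | mem y hy => obtain ⟨m, rfl⟩ := hy; exact h m
  | zero => simp
  | add y z _ _ hy hz => simp [hy, hz]
  | smul r y _ hy => simp [hy]

namespace AlgebraicGeometry.Scheme.Modules

variable {X : Scheme.{0}}

/-- Restriction of sections of an `𝒪_X`-module from `U` to `V ⊆ U`, as a map that is semilinear
along the restriction of functions. -/
def restrictSections (M : X.Modules) {U V : X.Opens} (h : V ≤ U) :
    Γ(M, U) →ₛₗ[(X.presheaf.map (homOfLE h).op).hom] Γ(M, V) where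
  toFun m := M.presheaf.map (homOfLE h).op m
  map_add' x y := map_add _ x y
  map_smul' r x := Scheme.Modules.map_smul M (homOfLE h) r x

/-- The presheaf of abelian groups `U ↦ ⋀ⁿ_{𝒪(U)} M(U)`. -/
def exteriorPowerPresheafAb (M : X.Modules) (n : ℕ) : X.Opensᵒᵖ ⥤ Ab.{0} where
  obj U := AddCommGrpCat.of (⋀[Γ(X, U.unop)]^n Γ(M, U.unop))
  map {U V} f := AddCommGrpCat.ofHom
    (exteriorPowerMapSemilinear (M.restrictSections (leOfHom f.unop)) n).toAddMonoidHom
  map_id U := by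
    refine AddCommGrpCat.hom_ext (AddMonoidHom.ext fun x => ?_)
    let φ := exteriorPowerMapSemilinear (M.restrictSections (leOfHom (𝟙 U.unop))) n
    let ψ : ⋀[Γ(X, U.unop)]^n Γ(M, U.unop)
        →ₛₗ[(X.presheaf.map (homOfLE (leOfHom (𝟙 U.unop))).op).hom]
          ⋀[Γ(X, U.unop)]^n Γ(M, U.unop) :=
      { toFun := id
        map_add' := fun _ _ => rfl
        map_smul' := fun r x => by
          have : (X.presheaf.map (homOfLE (leOfHom (𝟙 U.unop))).op).hom r = r :=
            congr($(X.presheaf.map_id U) r)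
          change r • x = (X.presheaf.map (homOfLE (leOfHom (𝟙 U.unop))).op).hom r • x
          rw [this] }
    refine exteriorPower_semilinear_ext φ ψ (fun m => ?_) x
    refine (exteriorPowerMapSemilinear_ιMulti _ _ _).trans ?_
    change _ = exteriorPower.ιMulti _ n m
    congr 1
    funext i
    exact congr($(M.presheaf.map_id U) (m i))
  map_comp {U V W} f g := by
    refine AddCommGrpCat.hom_ext (AddMonoidHom.ext fun x => ?_)
    let φ := exteriorPowerMapSemilinear (M.restrictSections (leOfHom (f ≫ g).unop)) n
    let φ₁ := exteriorPowerMapSemilinear (M.restrictSections (leOfHom f.unop)) n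
    let φ₂ := exteriorPowerMapSemilinear (M.restrictSections (leOfHom g.unop)) n
    let ψ : ⋀[Γ(X, U.unop)]^n Γ(M, U.unop)
        →ₛₗ[(X.presheaf.map (homOfLE (leOfHom (f ≫ g).unop)).op).hom]
          ⋀[Γ(X, W.unop)]^n Γ(M, W.unop) :=
      { toFun := fun x => φ₂ (φ₁ x)
        map_add' := fun _ _ => by simp
        map_smul' := fun r x => by
          rw [map_smulₛₗ, map_smulₛₗ]
          congr 1
          exact congr($(X.presheaf.map_comp f g) r).symm }
    refine exteriorPower_semilinear_ext φ ψ (fun m => ?_) x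
    refine (exteriorPowerMapSemilinear_ιMulti _ _ _).trans ?_
    change _ = φ₂ (φ₁ (exteriorPower.ιMulti _ n m))
    rw [exteriorPowerMapSemilinear_ιMulti, exteriorPowerMapSemilinear_ιMulti]
    congr 1
    funext i
    exact congr($(M.presheaf.map_comp f g) (m i))

instance (M : X.Modules) (n : ℕ) (U : X.Opensᵒᵖ) :
    Module (X.ringCatSheaf.obj.obj U) ((exteriorPowerPresheafAb M n).obj U) :=
  inferInstanceAs (Module Γ(X, U.unop) (⋀[Γ(X, U.unop)]^n Γ(M, U.unop)))

/-- The presheaf of `𝒪_X`-modules `U ↦ ⋀ⁿ_{𝒪(U)} M(U)`. -/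
def exteriorPowerPresheaf (M : X.Modules) (n : ℕ) : X.PresheafOfModules :=
  PresheafOfModules.ofPresheaf (R := X.ringCatSheaf.obj) (exteriorPowerPresheafAb M n) (by
    intro U V f r m
    exact (exteriorPowerMapSemilinear (M.restrictSections (leOfHom f.unop)) n).map_smulₛₗ r m)

/-- The `n`-th exterior power `⋀ⁿ M` of an `𝒪_X`-module: the sheaf associated with the presheaf
`U ↦ ⋀ⁿ_{𝒪(U)} M(U)`. -/
def extPower (M : X.Modules) (n : ℕ) : X.Modules :=
  (PresheafOfModules.sheafification (𝟙 X.ringCatSheaf.obj)).obj (exteriorPowerPresheaf M n)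

/-- The canonical map `⋀ⁿ_{𝒪(U)} M(U) → (⋀ⁿ M)(U)`. -/
def toExtPower (M : X.Modules) (n : ℕ) (U : X.Opens) :
    ⋀[Γ(X, U)]^n Γ(M, U) →+ Γ(M.extPower n, U) :=
  ((toSheafify (Opens.grothendieckTopology X) (exteriorPowerPresheafAb M n)).app (op U)).hom

/-! ### Frames, vector bundles, globally generated sheaves -/

/-- A frame (local trivialization) of rank `r` of `M` over `U`: sections `e₁, …, e_r ∈ M(U)` for
which `𝒪_U^r → M|_U`, `(c_i) ↦ ∑ c_i e_i`, is an isomorphism. -/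
structure Frame (M : X.Modules) (r : ℕ) (U : X.Opens) where
  /-- the sections of the frame -/
  e : Fin r → Γ(M, U)
  bijective : ∀ (V : X.Opens) (hVU : V ≤ U),
    Function.Bijective fun c : Fin r → Γ(X, V) => ∑ i, c i • M.restrictSections hVU (e i)

/-- `M` is locally free of rank `r`, i.e. (the sheaf of sections of) a vector bundle of rank `r`. -/
def IsVectorBundle (M : X.Modules) (r : ℕ) : Prop :=
  ∀ x : X, ∃ U : X.Opens, x ∈ U ∧ Nonempty (M.Frame r U)

/-- `M` is generated by its global sections: some family of global sections defines an epimorphism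
from a free `𝒪_X`-module onto `M`. -/
def IsGloballyGenerated (M : X.Modules) : Prop :=
  Nonempty (SheafOfModules.GeneratingSections (R := X.ringCatSheaf) M)

variable (X) in
/-- The structure sheaf `𝒪_X` as an `𝒪_X`-module. -/
def structureSheaf : X.Modules := SheafOfModules.unit X.ringCatSheaf

instance : HasFiniteBiproducts X.Modules := Abelian.hasFiniteBiproducts

/-! ### Complex schemes and spaces of global sections -/

/-- The complex constants inside the functions on an open subset of a `ℂ`-scheme. -/
def constants (π : X ⟶ Spec (.of ℂ)) (U : X.Opens) : ℂ →+* Γ(X, U) :=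
  (X.presheaf.map (homOfLE le_top).op).hom.comp
    (π.appTop.hom.comp (Scheme.ΓSpecIso (.of ℂ)).inv.hom)

/-- `H⁰(X, M)`, as a complex vector space, for a complex scheme `π : X ⟶ Spec ℂ`. -/
def H0 (_ : X ⟶ Spec (.of ℂ)) (M : X.Modules) : Type := Γ(M, ⊤)

instance (π : X ⟶ Spec (.of ℂ)) (M : X.Modules) : AddCommGroup (H0 π M) :=
  inferInstanceAs (AddCommGroup Γ(M, ⊤))

instance (π : X ⟶ Spec (.of ℂ)) (M : X.Modules) : Module ℂ (H0 π M) :=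
  Module.compHom Γ(M, ⊤) (constants π ⊤)

/-- The restriction of a global section to `U`. -/
def H0.restrict {π : X ⟶ Spec (.of ℂ)} {M : X.Modules} (s : H0 π M) (U : X.Opens) : Γ(M, U) :=
  M.restrictSections le_top (show Γ(M, ⊤) from s)

/-! ### Zero loci and orbital degeneracy loci

Closed subschemes of `X` are given by their quasi-coherent ideal sheaves; a smaller ideal sheaf is
a larger closed subscheme. -/

/-- The scheme-theoretic zero locus `𝒵(t)` of a section `t` of a vector bundle `F` of rank `r`.
Its ideal sheaf is the one generated by the coordinates of `t` in local frames of `F`. -/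
def zeroLocus {π : X ⟶ Spec (.of ℂ)} {F : X.Modules} (r : ℕ) (t : H0 π F) :
    X.IdealSheafData :=
  sInf {I | ∀ (U : X.affineOpens) (b : F.Frame r U) (c : Fin r → Γ(X, U)),
    t.restrict U = ∑ i, c i • b.e i → ∀ i, c i ∈ I.ideal U}

/-- The coordinates of an `n`-vector in `⋀ⁿ ℂ^r` with respect to the basis
`e_{i₁} ∧ … ∧ e_{iₙ}`, `i₁ < … < iₙ`. -/
def nVectorCoord {r n : ℕ} (y : ⋀[ℂ]^n (Fin r → ℂ)) : Set.powersetCard (Fin r) n → ℂ :=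
  ((Pi.basisFun ℂ (Fin r)).exteriorPower n).repr y

/-- The ideal of a subset `Y` of the affine space `⋀ⁿ ℂ^r`: all polynomials vanishing on `Y`. -/
def nVectorIdeal {r n : ℕ} (Y : Set (⋀[ℂ]^n (Fin r → ℂ))) :
    Ideal (MvPolynomial (Set.powersetCard (Fin r) n) ℂ) :=
  MvPolynomial.vanishingIdeal ℂ (nVectorCoord '' Y)

/-- The orbital degeneracy locus `D_Y(s)` of a section `s` of `⋀ⁿ E`, where `E` is a vector bundle
of rank `r` on `X` and `Y ⊆ ⋀ⁿ ℂ^r` is a `GL_r`-stable closed subvariety: the scheme-theoretic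
preimage under `s : X → ⋀ⁿ E` of the subbundle with fibre `Y`. In a frame `b` of `E` over `U`, the
section `s` is a map `c : U → ⋀ⁿ ℂ^r`, and the ideal of `D_Y(s)` is generated by the pullbacks
`f(c)` of the equations `f` of `Y`. -/
def degeneracyLocus {π : X ⟶ Spec (.of ℂ)} {E : X.Modules} {r n : ℕ}
    (Y : Set (⋀[ℂ]^n (Fin r → ℂ))) (s : H0 π (E.extPower n)) : X.IdealSheafData :=
  sInf {I | ∀ (U : X.affineOpens) (b : E.Frame r U)
    (c : Set.powersetCard (Fin r) n → Γ(X, U)),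
    s.restrict U =
      ∑ S, c S • E.toExtPower n U (exteriorPower.ιMulti_family Γ(X, U) n b.e S) →
    ∀ f ∈ nVectorIdeal Y, f.eval₂ (constants π U) c ∈ I.ideal U}

end AlgebraicGeometry.Scheme.Modules

/-- The variety `Y ⊆ ⋀³ ℂ⁶` of partially decomposable three-forms `v ∧ ω`, with `v ∈ ℂ⁶` and
`ω ∈ ⋀² ℂ⁶`. -/
def partiallyDecomposable : Set (⋀[ℂ]^3 (Fin 6 → ℂ)) :=
  {y | ∃ (v : Fin 6 → ℂ) (ω : ⋀[ℂ]^2 (Fin 6 → ℂ)),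
    (y : ExteriorAlgebra ℂ (Fin 6 → ℂ)) = ExteriorAlgebra.ι ℂ v * ω}

/-! ### General elements of a vector space -/

/-- The algebra of polynomial functions on a complex vector space, generated by linear forms. -/
def polyFunctions (W : Type*) [AddCommGroup W] [Module ℂ W] : Subalgebra ℂ (W → ℂ) :=
  Algebra.adjoin ℂ (Set.range fun (l : Module.Dual ℂ W) (w : W) => l w)

/-- Zariski open subsets of a complex vector space. -/
def IsZariskiOpen {W : Type*} [AddCommGroup W] [Module ℂ W] (U : Set W) : Prop :=
  ∃ A ⊆ (polyFunctions W : Set (W → ℂ)), U = {w | ∃ p ∈ A, p w ≠ 0}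

/-- A property holds for a general element of a complex vector space if it holds on some non-empty
Zariski open subset. -/
def HoldsForGeneral {W : Type*} [AddCommGroup W] [Module ℂ W] (P : W → Prop) : Prop :=
  ∃ U : Set W, IsZariskiOpen U ∧ U.Nonempty ∧ ∀ w ∈ U, P w

end

/-! Split `ℂ⁶` as `ℂ e₀ ⊕ ℂ⁵`. A section of `⋀³ (L ⊕ 5 𝒪)` has the form `e₀ ∧ β + θ`, where `θ` is a
three-form in five variables with functions as coefficients and `β` is a two-form with coefficients
in `L`. Global functions on `X` are constants (`constants_bijective`), so `θ` is a constant
three-form and may be taken generic.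

Let `w` be the Pfaffian vector of `θ`. If `e₀ ∧ β + θ` is partially decomposable, then `2 w ∧ β = (θ
∧ β) θ`. For fixed `θ` in the open set `IsGood` this condition is linear in `β` of rank five: five
coordinates, the `cubics`, imply it, and it is then also sufficient (`exists_wedgeCoord`). Evaluated
at the components of `s`, these five expressions are sections of `L`, and together they form `T(s)`.

The equality of loci is scheme-theoretic, yet no generators of the full ideal of `Y` are needed. A
linear right inverse of `β ↦ cubics θ β` gives a retraction `cubicsProj` of the forms with good part
`θ` onto those in `Y`. Every equation of `Y` vanishes identically after this retraction, and the
retraction changes coordinates only by multiples of the cubics, so every equation lies in the ideal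
of the cubics (`eval₂_mem_span_cubics`). Conversely, the cubics are equations of `Y`
(`cubicPoly_mem`). This takes place in frames of `E` induced by frames of `L`; `eval₂_repr_mem_span`
passes to arbitrary frames, because `Y` is stable under all matrices.

Finally `T` is a polynomial map, and it is surjective since the cubics can be solved for `β` at one
good `θ`. Hence a non-empty Zariski open set pulls back to a non-empty Zariski open set. -/

noncomputable section

/-! ### Three-element subsets of six elements -/

/-- The three-element subset `{i < j < k}` of `Fin 6`. -/
def triple (i j k : Fin 6) (hij : i < j := by decide) (hjk : j < k := by decide) :
    Set.powersetCard (Fin 6) 3 :=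
  Set.powersetCard.ofFinEmbEquiv <| OrderEmbedding.ofStrictMono ![i, j, k] <| by
    intro a b h
    fin_cases a <;> fin_cases b <;> first
      | exact absurd h (by decide)
      | simp [hij, hjk, hij.trans hjk]

/-- The elements of a three-element subset of `Fin 6`, in increasing order. -/
abbrev nth (S : Set.powersetCard (Fin 6) 3) : Fin 3 ↪o Fin 6 :=
  Set.powersetCard.ofFinEmbEquiv.symm S

@[simp]
theorem nth_triple (i j k : Fin 6) (hij : i < j) (hjk : j < k) (a : Fin 3) :
    nth (triple i j k hij hjk) a = ![i, j, k] a := by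
  simp only [nth, triple, Equiv.symm_apply_apply]
  rfl

theorem nth_lt (S : Set.powersetCard (Fin 6) 3) : nth S 0 < nth S 1 ∧ nth S 1 < nth S 2 :=
  ⟨(nth S).strictMono (by decide), (nth S).strictMono (by decide)⟩

theorem triple_nth (S : Set.powersetCard (Fin 6) 3) :
    triple (nth S 0) (nth S 1) (nth S 2) (nth_lt S).1 (nth_lt S).2 = S := by
  apply Set.powersetCard.ofFinEmbEquiv.symm.injective
  ext a
  change ((nth _ a : Fin 6) : ℕ) = nth S a
  rw [nth_triple]
  fin_cases a <;> rfl

/-- A property of three-element subsets can be checked on the twenty triples. -/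
theorem forall_triple {P : Set.powersetCard (Fin 6) 3 → Prop}
    (h : ∀ (i j k : Fin 6) (hij : i < j) (hjk : j < k), P (triple i j k hij hjk))
    (S : Set.powersetCard (Fin 6) 3) : P S := by
  rw [← triple_nth S]; exact h _ _ _ _ _

/-! ### The cubic equations -/

section Cubics

variable {R : Type*} [CommRing R] {M : Type*} [AddCommGroup M] [Module R M]

/-- The Pfaffians of a three-form in the variables `1, …, 5`: if the form is `v ∧ ω`, they are
proportional to the coordinates of `v`. -/
def pfaffianVector (θ : Set.powersetCard (Fin 6) 3 → R) : Fin 6 → R :=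
  ![0,
    θ (triple 1 2 3) * θ (triple 1 4 5) - θ (triple 1 2 4) * θ (triple 1 3 5)
      + θ (triple 1 2 5) * θ (triple 1 3 4),
    θ (triple 1 2 3) * θ (triple 2 4 5) - θ (triple 1 2 4) * θ (triple 2 3 5)
      + θ (triple 1 2 5) * θ (triple 2 3 4),
    θ (triple 1 2 3) * θ (triple 3 4 5) - θ (triple 1 3 4) * θ (triple 2 3 5)
      + θ (triple 1 3 5) * θ (triple 2 3 4),
    θ (triple 1 2 4) * θ (triple 3 4 5) - θ (triple 1 3 4) * θ (triple 2 4 5)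
      + θ (triple 1 4 5) * θ (triple 2 3 4),
    θ (triple 1 2 5) * θ (triple 3 4 5) - θ (triple 1 3 5) * θ (triple 2 4 5)
      + θ (triple 1 4 5) * θ (triple 2 3 5)]

/-- The coefficient of `θ ∧ β`, where `θ` is a three-form in the variables `1, …, 5` and `β` is the
two-form in these variables whose coordinates are `m {0, j, k}`. -/
def topCoeff (θ : Set.powersetCard (Fin 6) 3 → R) (m : Set.powersetCard (Fin 6) 3 → M) : M :=
  θ (triple 1 2 3) • m (triple 0 4 5) - θ (triple 1 2 4) • m (triple 0 3 5)
    + θ (triple 1 2 5) • m (triple 0 3 4) + θ (triple 1 3 4) • m (triple 0 2 5)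
    - θ (triple 1 3 5) • m (triple 0 2 4) + θ (triple 1 4 5) • m (triple 0 2 3)
    - θ (triple 2 3 4) • m (triple 0 1 5) + θ (triple 2 3 5) • m (triple 0 1 4)
    - θ (triple 2 4 5) • m (triple 0 1 3) + θ (triple 3 4 5) • m (triple 0 1 2)

/-- Five of the coordinates of `2 w ∧ β - (θ ∧ β) θ`, where `w` is the Pfaffian vector of `θ`. -/
def cubics (θ : Set.powersetCard (Fin 6) 3 → R) (m : Set.powersetCard (Fin 6) 3 → M) :
    Fin 5 → M :=
  let w := pfaffianVector θ
  ![(2 * w 1) • m (triple 0 2 3) - (2 * w 2) • m (triple 0 1 3) + (2 * w 3) • m (triple 0 1 2)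
      - θ (triple 1 2 3) • topCoeff θ m,
    (2 * w 1) • m (triple 0 2 4) - (2 * w 2) • m (triple 0 1 4) + (2 * w 4) • m (triple 0 1 2)
      - θ (triple 1 2 4) • topCoeff θ m,
    (2 * w 1) • m (triple 0 2 5) - (2 * w 2) • m (triple 0 1 5) + (2 * w 5) • m (triple 0 1 2)
      - θ (triple 1 2 5) • topCoeff θ m,
    (2 * w 1) • m (triple 0 3 4) - (2 * w 3) • m (triple 0 1 4) + (2 * w 4) • m (triple 0 1 3)
      - θ (triple 1 3 4) • topCoeff θ m,
    (2 * w 1) • m (triple 0 3 5) - (2 * w 3) • m (triple 0 1 5) + (2 * w 5) • m (triple 0 1 3)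
      - θ (triple 1 3 5) • topCoeff θ m]

/-- Both arguments are indexed by all triples, but `θ` is only read off the triples without `0` and
`m` only on those with `0`. Values at the other indices are junk, and one family `c` can serve as
both arguments. -/
theorem cubics_congr {θ θ' : Set.powersetCard (Fin 6) 3 → R} {m m' : Set.powersetCard (Fin 6) 3 → M}
    (hθ : ∀ S, nth S 0 ≠ 0 → θ S = θ' S) (hm : ∀ S, nth S 0 = 0 → m S = m' S) :
    cubics θ m = cubics θ' m' := by
  have h1 (i j k : Fin 6) (hij : i < j) (hjk : j < k) (h : i ≠ 0) :
      θ (triple i j k hij hjk) = θ' (triple i j k hij hjk) := hθ _ (by simpa using h)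
  have h2 (j k : Fin 6) (hij : 0 < j) (hjk : j < k) :
      m (triple 0 j k hij hjk) = m' (triple 0 j k hij hjk) := hm _ (by simp)
  simp [cubics, topCoeff, pfaffianVector, h1, h2]

theorem map_topCoeff {S N : Type*} [CommRing S] [AddCommGroup N] [Module S N] {σ : R →+* S}
    (f : M →ₛₗ[σ] N) (θ : Set.powersetCard (Fin 6) 3 → R) (m : Set.powersetCard (Fin 6) 3 → M) :
    f (topCoeff θ m) = topCoeff (fun S => σ (θ S)) (fun S => f (m S)) := by
  simp [topCoeff]

theorem map_pfaffianVector {S : Type*} [CommRing S] (σ : R →+* S)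
    (θ : Set.powersetCard (Fin 6) 3 → R) (i : Fin 6) :
    σ (pfaffianVector θ i) = pfaffianVector (fun S => σ (θ S)) i := by
  fin_cases i <;> simp [pfaffianVector]

/-- Naturality in coefficients. It covers evaluation of polynomials, restriction of sections,
multiplication by a local generator of `L`, and linear forms on spaces of sections. -/
theorem map_cubics {S N : Type*} [CommRing S] [AddCommGroup N] [Module S N] {σ : R →+* S}
    (f : M →ₛₗ[σ] N) (θ : Set.powersetCard (Fin 6) 3 → R) (m : Set.powersetCard (Fin 6) 3 → M)
    (i : Fin 5) :
    f (cubics θ m i) = cubics (fun S => σ (θ S)) (fun S => f (m S)) i := by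
  fin_cases i <;> simp [cubics, map_topCoeff, map_pfaffianVector, map_ofNat]

theorem cubics_sub (θ : Set.powersetCard (Fin 6) 3 → R) (m m' : Set.powersetCard (Fin 6) 3 → M) :
    cubics θ (m - m') = cubics θ m - cubics θ m' := by
  funext i
  fin_cases i <;> simp [cubics, topCoeff] <;> module

theorem cubics_add (θ : Set.powersetCard (Fin 6) 3 → R) (m m' : Set.powersetCard (Fin 6) 3 → M) :
    cubics θ (m + m') = cubics θ m + cubics θ m' := by
  funext i
  fin_cases i <;> simp [cubics, topCoeff] <;> module

theorem cubics_smul (θ : Set.powersetCard (Fin 6) 3 → R) (r : R)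
    (m : Set.powersetCard (Fin 6) 3 → M) :
    cubics θ (r • m) = r • cubics θ m := by
  funext i
  fin_cases i <;> simp [cubics, topCoeff] <;> module

/-- The coordinates of `v ∧ ω`, where `a` is the skew-symmetric matrix of coordinates of `ω`. -/
def wedgeCoord (v : Fin 6 → R) (a : Fin 6 → Fin 6 → R) (S : Set.powersetCard (Fin 6) 3) : R :=
  v (nth S 0) * a (nth S 1) (nth S 2) - v (nth S 1) * a (nth S 0) (nth S 2)
    + v (nth S 2) * a (nth S 0) (nth S 1)

/-- Write `v = z e₀ + v'` and `ω = e₀ ∧ u + ω'`. Then `θ = v' ∧ ω'` and `β = z ω' - v' ∧ u`, so `v'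
∧ β = z θ`. The Pfaffian vector is `k v'`, where `2k` is the coefficient of `v'`-free volume in the
sense that `θ ∧ ω' = 2k`, so `θ ∧ β = 2kz`. Skew-symmetry of `a` plays no role, as only entries
above the diagonal enter. -/
theorem cubics_wedgeCoord (v : Fin 6 → R) (a : Fin 6 → Fin 6 → R) :
    cubics (wedgeCoord v a) (wedgeCoord v a) = 0 := by
  funext i
  fin_cases i <;> simp [cubics, topCoeff, pfaffianVector, wedgeCoord] <;> ring

end Cubics

/-- The open condition on a three-form under which the five cubics have maximal rank. -/
def IsGood (θ : Set.powersetCard (Fin 6) 3 → ℂ) : Prop :=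
  θ (triple 1 2 3) * pfaffianVector θ 1 ≠ 0

/-- The candidate for `v` is the Pfaffian vector `w` completed by `(θ ∧ β) / 2` in the direction
`e₀`, as the computation for a decomposable form dictates. Contracting `v ∧ ω` with the dual vector
of `e₁` gives `v₁ ω` modulo `v`, so `ω` can be taken to be the contraction of `c` divided by `w 1`.
-/
theorem exists_wedgeCoord {c : Set.powersetCard (Fin 6) 3 → ℂ} (hc : IsGood c)
    (h : cubics c c = 0) :
    ∃ (v : Fin 6 → ℂ) (a : Fin 6 → Fin 6 → ℂ), (∀ i j, a i j = - a j i) ∧ c = wedgeCoord v a := by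
  obtain ⟨h3, hw⟩ := mul_ne_zero_iff.1 hc
  obtain ⟨w, hwdef⟩ : ∃ w, w = pfaffianVector c := ⟨_, rfl⟩
  -- The upper triangular half of the contraction of `c` with the dual of `e₁`; the sign comes from
  -- moving the index `1` in front of `0`.
  let C : Fin 6 → Fin 6 → ℂ := fun j k =>
    if hj : 1 < j ∧ j < k then c (triple 1 j k hj.1 hj.2)
    else if hk : j = 0 ∧ 1 < k then - c (triple 0 1 k (by decide) hk.2) else 0
  have h1 := congr_fun h 0
  have h2 := congr_fun h 1
  have h4 := congr_fun h 2
  have h5 := congr_fun h 3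
  have h6 := congr_fun h 4
  -- The coordinate `145` of `F = 2 w ∧ β - (θ ∧ β) θ`. It follows from the five cubics because the
  -- contractions of `F` and `θ` with the dual of `e₁` have vanishing wedge product in the variables
  -- `2, …, 5`, a relation in which `F₁₄₅` has coefficient `θ₁₂₃`.
  have h7 : 2 * w 1 * c (triple 0 4 5) - 2 * w 4 * c (triple 0 1 5) + 2 * w 5 * c (triple 0 1 4)
      - c (triple 1 4 5) * topCoeff c c = 0 := by
    apply mul_left_cancel₀ h3
    simp only [cubics, topCoeff, pfaffianVector, smul_eq_mul, Pi.zero_apply, Fin.isValue,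
      Matrix.cons_val, hwdef] at h1 h2 h4 h5 h6 ⊢
    linear_combination (- c (triple 1 4 5)) * h1 + c (triple 1 3 5) * h2 - c (triple 1 3 4) * h4
      - c (triple 1 2 5) * h5 + c (triple 1 2 4) * h6
  refine ⟨![topCoeff c c / 2, w 1, w 2, w 3, w 4, w 5], fun j k => (C j k - C k j) / w 1,
    fun j k => by ring, funext <| forall_triple fun i j k hij hjk => ?_⟩
  have hw' : w 1 ≠ 0 := hwdef ▸ hw
  have key : ∀ i j k : Fin 6, ∀ (hij : i < j) (hjk : j < k), c (triple i j k hij hjk) * w 1 =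
      wedgeCoord ![topCoeff c c / 2, w 1, w 2, w 3, w 4, w 5] (fun j k => C j k - C k j)
        (triple i j k hij hjk) := by
    intro i j k hij hjk
    fin_cases i <;> fin_cases j <;> first | exact absurd hij (by decide) | skip
    all_goals fin_cases k <;> first | exact absurd hjk (by decide) | skip
    all_goals
      simp only [cubics, topCoeff, pfaffianVector, smul_eq_mul, Pi.zero_apply, Fin.isValue,
        Matrix.cons_val, hwdef] at h1 h2 h4 h5 h6 h7
      simp [wedgeCoord, C, topCoeff, hwdef, pfaffianVector]
      first
        | ring1
        | linear_combination h1 / 2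
        | linear_combination h2 / 2
        | linear_combination h4 / 2
        | linear_combination h5 / 2
        | linear_combination h6 / 2
        | linear_combination h7 / 2
  apply mul_right_cancel₀ hw'
  rw [key]
  simp only [wedgeCoord]
  field_simp

/-! ### The ideal of partially decomposable forms and the five cubics -/

section PartiallyDecomposable

open AlgebraicGeometry.Scheme.Modules (nVectorCoord nVectorIdeal)

/-- A right inverse of `m ↦ cubics θ m` for a good three-form `θ`. -/
def cubicsSection {M : Type*} [AddCommGroup M] [Module ℂ M]
    (θ : Set.powersetCard (Fin 6) 3 → ℂ) (t : Fin 5 → M) (S : Set.powersetCard (Fin 6) 3) : M :=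
  let u : M := (θ (triple 1 2 3))⁻¹ • (θ (triple 1 2 4) • t 4 - θ (triple 1 2 5) • t 3
    - θ (triple 1 3 4) • t 2 + θ (triple 1 3 5) • t 1 - θ (triple 1 4 5) • t 0)
  let g : Fin 6 → Fin 6 → M :=
    ![0, 0, ![0, 0, 0, t 0, t 1, t 2], ![0, 0, 0, 0, t 3, t 4], ![0, 0, 0, 0, 0, u], 0]
  if nth S 0 = 0 then (2 * pfaffianVector θ 1)⁻¹ • g (nth S 1) (nth S 2) else 0

/-- The preimage `β` has no component along `e₁`, and its `45` entry, built from `u`, is chosen to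
make `θ ∧ β = 0`. The coordinate `1jk` of the form then reduces to `2 w₁ β_jk`, which is inverted
directly. -/
theorem cubics_cubicsSection {M : Type*} [AddCommGroup M] [Module ℂ M]
    {θ : Set.powersetCard (Fin 6) 3 → ℂ} (hθ : IsGood θ) (t : Fin 5 → M) :
    cubics θ (cubicsSection θ t) = t := by
  obtain ⟨h3, hw⟩ := mul_ne_zero_iff.1 hθ
  have h0 : topCoeff θ (cubicsSection θ t) = 0 := by
    simp only [topCoeff, cubicsSection, nth_triple, Matrix.cons_val, Fin.isValue, if_true,
      Pi.zero_apply, smul_zero]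
    generalize (2 * pfaffianVector θ 1)⁻¹ = z
    match_scalars <;> field_simp <;> ring
  have h2 : 2 * pfaffianVector θ 1 ≠ 0 := mul_ne_zero two_ne_zero hw
  funext i
  fin_cases i <;> simp [cubics, h0, cubicsSection, smul_smul, -mul_inv_rev, h2]

/-- The coordinates of a two-form. -/
def twoFormCoord (i j : Fin 6) : ⋀[ℂ]^2 (Fin 6 → ℂ) →ₗ[ℂ] ℂ :=
  exteriorPower.pairingDual ℂ (Fin 6 → ℂ) 2
    (exteriorPower.ιMulti ℂ 2 ![LinearMap.proj i, LinearMap.proj j])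

theorem twoFormCoord_ιMulti (i j : Fin 6) (x : Fin 2 → Fin 6 → ℂ) :
    twoFormCoord i j (exteriorPower.ιMulti ℂ 2 x) = x 0 i * x 1 j - x 0 j * x 1 i := by
  simp [twoFormCoord, Matrix.det_fin_two]

theorem exists_twoForm (a : Fin 6 → Fin 6 → ℂ) (ha : ∀ i j, a i j = - a j i) :
    ∃ ω, a = fun i j => twoFormCoord i j ω := by
  -- The sum meets each pair in both orders, hence the factor one half.
  refine ⟨∑ i, ∑ j, (a i j / 2) • exteriorPower.ιMulti ℂ 2 ![Pi.single i 1, Pi.single j 1], ?_⟩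
  funext k l
  simp only [map_sum, map_smul, twoFormCoord_ιMulti, Matrix.cons_val_zero, Matrix.cons_val_one,
    smul_eq_mul, mul_sub, Finset.sum_sub_distrib, Pi.single_apply, mul_ite, mul_one, mul_zero,
    Finset.sum_ite_eq, Finset.mem_univ, if_true]
  rw [ha l k]
  ring

/-- Multiplication by a vector, from two-forms to three-forms. -/
def wedgeVector (v : Fin 6 → ℂ) : ⋀[ℂ]^2 (Fin 6 → ℂ) →ₗ[ℂ] ⋀[ℂ]^3 (Fin 6 → ℂ) :=
  ((LinearMap.mulLeft ℂ (ExteriorAlgebra.ι ℂ v)).comp (Submodule.subtype _)).codRestrict _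
    fun ω => by
      have h := SetLike.mul_mem_graded (A := fun i : ℕ => ⋀[ℂ]^i (Fin 6 → ℂ)) (i := 1) (j := 2)
        (gi := ExteriorAlgebra.ι ℂ v) (gj := ω) (by simp [ExteriorAlgebra.exteriorPower]) ω.2
      exact h

theorem wedgeVector_ιMulti (v : Fin 6 → ℂ) (x : Fin 2 → Fin 6 → ℂ) :
    wedgeVector v (exteriorPower.ιMulti ℂ 2 x) =
      exteriorPower.ιMulti ℂ 3 (Matrix.vecCons v x) := by
  apply Subtype.ext
  change ExteriorAlgebra.ι ℂ v * ExteriorAlgebra.ιMulti ℂ 2 x = ExteriorAlgebra.ιMulti ℂ 3 _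
  rw [ExteriorAlgebra.ιMulti_succ_apply]
  rfl

/-- Laplace expansion of a three by three minor along the entries of `v`, checked on products of two
vectors. -/
theorem nVectorCoord_wedgeVector (v : Fin 6 → ℂ) (ω : ⋀[ℂ]^2 (Fin 6 → ℂ)) :
    nVectorCoord (wedgeVector v ω) = wedgeCoord v (fun i j => twoFormCoord i j ω) := by
  funext S
  have : (exteriorPower.ιMultiDual ℂ 3 (Pi.basisFun ℂ (Fin 6)) S).comp (wedgeVector v) =
      v (nth S 0) • twoFormCoord (nth S 1) (nth S 2) - v (nth S 1) • twoFormCoord (nth S 0) (nth S 2)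
      + v (nth S 2) • twoFormCoord (nth S 0) (nth S 1) := by
    apply exteriorPower.linearMap_ext
    ext x
    simp [wedgeVector_ιMulti, twoFormCoord_ιMulti, Matrix.det_fin_three]
    ring
  simpa [nVectorCoord, exteriorPower.basis_repr_apply, wedgeCoord] using LinearMap.congr_fun this ω

theorem mem_partiallyDecomposable_iff {y : ⋀[ℂ]^3 (Fin 6 → ℂ)} :
    y ∈ partiallyDecomposable ↔ ∃ v ω, y = wedgeVector v ω := by
  simp only [Subtype.ext_iff]; rfl

/-- The coordinates of partially decomposable three-forms. -/
theorem mem_nVectorCoord_image_iff {c : Set.powersetCard (Fin 6) 3 → ℂ} :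
    c ∈ nVectorCoord '' partiallyDecomposable ↔
      ∃ (v : Fin 6 → ℂ) (a : Fin 6 → Fin 6 → ℂ), (∀ i j, a i j = - a j i) ∧ c = wedgeCoord v a := by
  constructor
  · rintro ⟨y, hy, rfl⟩
    obtain ⟨v, ω, rfl⟩ := mem_partiallyDecomposable_iff.1 hy
    refine ⟨v, _, fun i j => ?_, nVectorCoord_wedgeVector v ω⟩
    have : twoFormCoord i j = - twoFormCoord j i := by
      apply exteriorPower.linearMap_ext
      ext x
      simp [twoFormCoord_ιMulti]
    rw [this]; rfl
  · rintro ⟨v, a, ha, rfl⟩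
    obtain ⟨ω, rfl⟩ := exists_twoForm a ha
    exact ⟨wedgeVector v ω, mem_partiallyDecomposable_iff.2 ⟨v, ω, rfl⟩,
      nVectorCoord_wedgeVector v ω⟩

theorem mem_image_of_cubics_eq_zero {c : Set.powersetCard (Fin 6) 3 → ℂ} (hc : IsGood c)
    (h : cubics c c = 0) : c ∈ nVectorCoord '' partiallyDecomposable :=
  mem_nVectorCoord_image_iff.2 (exists_wedgeCoord hc h)

theorem mem_nVectorIdeal_iff {r n : ℕ} {Y : Set (⋀[ℂ]^n (Fin r → ℂ))}
    {f : MvPolynomial (Set.powersetCard (Fin r) n) ℂ} :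
    f ∈ nVectorIdeal Y ↔ ∀ x ∈ nVectorCoord '' Y, f.eval₂ (RingHom.id ℂ) x = 0 := by
  rw [nVectorIdeal, MvPolynomial.mem_vanishingIdeal_iff]
  rfl

/-- The cubics, as polynomials. -/
def cubicPoly : Fin 5 → MvPolynomial (Set.powersetCard (Fin 6) 3) ℂ :=
  cubics (R := MvPolynomial (Set.powersetCard (Fin 6) 3) ℂ) MvPolynomial.X MvPolynomial.X

theorem map_cubics_self {R S : Type*} [CommRing R] [CommRing S] (σ : R →+* S)
    (c : Set.powersetCard (Fin 6) 3 → R) (i : Fin 5) :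
    σ (cubics c c i) = cubics (fun S => σ (c S)) (fun S => σ (c S)) i :=
  map_cubics (R := R) (M := R) (N := S) (σ := σ) σ.toSemilinearMap c c i

theorem eval₂_cubicPoly {R : Type*} [CommRing R] (σ : ℂ →+* R)
    (c : Set.powersetCard (Fin 6) 3 → R) (i : Fin 5) :
    (cubicPoly i).eval₂ σ c = cubics c c i := by
  have := map_cubics_self (MvPolynomial.eval₂Hom σ c) MvPolynomial.X i
  simpa [cubicPoly] using this

theorem cubicPoly_mem (i : Fin 5) : cubicPoly i ∈ nVectorIdeal partiallyDecomposable := by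
  rw [mem_nVectorIdeal_iff]
  intro x hx
  obtain ⟨v, a, -, rfl⟩ := mem_nVectorCoord_image_iff.1 hx
  rw [eval₂_cubicPoly, cubics_wedgeCoord, Pi.zero_apply]

/-- For a good constant three-form `θ`, the part of `c` involving the variable `0` is moved into the
common kernel of the cubics at `θ`. -/
def cubicsProj {R : Type*} [CommRing R] (τ : ℂ →+* R) (θ : Set.powersetCard (Fin 6) 3 → ℂ)
    (c : Set.powersetCard (Fin 6) 3 → R) (S : Set.powersetCard (Fin 6) 3) : R :=
  c S - ∑ i, cubics c c i * τ (cubicsSection θ (Pi.single i 1) S)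

theorem map_cubicsProj {R A : Type*} [CommRing R] [CommRing A] (σ : R →+* A) (τ : ℂ →+* R)
    (θ : Set.powersetCard (Fin 6) 3 → ℂ) (c : Set.powersetCard (Fin 6) 3 → R)
    (S : Set.powersetCard (Fin 6) 3) :
    σ (cubicsProj τ θ c S) = cubicsProj (σ.comp τ) θ (fun S => σ (c S)) S := by
  simp [cubicsProj, map_cubics_self]

theorem cubicsProj_of_ne {R : Type*} [CommRing R] (τ : ℂ →+* R)
    (θ : Set.powersetCard (Fin 6) 3 → ℂ) (c : Set.powersetCard (Fin 6) 3 → R)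
    {S : Set.powersetCard (Fin 6) 3} (h : nth S 0 ≠ 0) : cubicsProj τ θ c S = c S := by
  simp [cubicsProj, cubicsSection, h]

theorem cubics_sum {R M : Type*} [CommRing R] [AddCommGroup M] [Module R M] {ι : Type*}
    (θ : Set.powersetCard (Fin 6) 3 → R) (s : Finset ι) (m : ι → Set.powersetCard (Fin 6) 3 → M) :
    cubics θ (∑ i ∈ s, m i) = ∑ i ∈ s, cubics θ (m i) := by
  let F : (Set.powersetCard (Fin 6) 3 → M) →+ (Fin 5 → M) := AddMonoidHom.mk' _ (cubics_add θ)
  exact map_sum F _ _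

/-- Subtracting the right inverse applied to the cubics makes the cubics vanish, by linearity in
`β`. The part `θ` is untouched and stays good, so the converse criterion applies. -/
theorem cubicsProj_mem {θ c : Set.powersetCard (Fin 6) 3 → ℂ} (hθ : IsGood θ)
    (hc : ∀ S, nth S 0 ≠ 0 → c S = θ S) :
    cubicsProj (.id ℂ) θ c ∈ nVectorCoord '' partiallyDecomposable := by
  have h3 (S) (h : nth S 0 ≠ 0) : cubicsProj (.id ℂ) θ c S = θ S := by
    rw [cubicsProj_of_ne _ _ _ h, hc _ h]
  apply mem_image_of_cubics_eq_zero
  · have h3' (i j k : Fin 6) (hij : i < j) (hjk : j < k) (h : i ≠ 0) :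
        cubicsProj (.id ℂ) θ c (triple i j k hij hjk) = θ (triple i j k hij hjk) :=
      h3 _ (by simpa using h)
    simpa [IsGood, pfaffianVector, h3'] using hθ
  · have e : cubicsProj (.id ℂ) θ c =
        c - ∑ i, cubics c c i • cubicsSection θ (Pi.single i 1) := by
      funext S
      simp [cubicsProj]
    have e' : ∑ i, cubics c c i • (Pi.single i 1 : Fin 5 → ℂ) = cubics c c := by
      rw [← pi_eq_sum_univ' (cubics c c)]
    rw [cubics_congr h3 (fun _ _ => rfl), e, cubics_sub, cubics_sum]
    simp only [cubics_smul, cubics_cubicsSection hθ]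
    rw [e', cubics_congr (θ := c) hc (fun _ _ => rfl), sub_self]

/-- If `c` is a three-form with coefficients in a ring whose part not involving the variable `0` is
constant and good, then all equations of partially decomposable forms at `c` lie in the
ideal generated by the five cubics. -/
theorem eval₂_mem_span_cubics {R : Type*} [CommRing R] (σ : ℂ →+* R)
    {θ : Set.powersetCard (Fin 6) 3 → ℂ} (hθ : IsGood θ) (c : Set.powersetCard (Fin 6) 3 → R)
    (hc : ∀ S, nth S 0 ≠ 0 → c S = σ (θ S))
    {f : MvPolynomial (Set.powersetCard (Fin 6) 3) ℂ}
    (hf : f ∈ nVectorIdeal partiallyDecomposable) :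
    f.eval₂ σ c ∈ Ideal.span (Set.range (cubics c c)) := by
  set I := Ideal.span (Set.range (cubics c c))
  have hproj : f.eval₂ σ (cubicsProj σ θ c) = 0 := by
    -- The universal form with part `θ`: coordinates involving `0` are free variables, the others
    -- are frozen. Vanishing of `f` on its projection is a polynomial identity over `ℂ`, so it is
    -- tested at complex points and then specialized to `c`.
    let X' (S : Set.powersetCard (Fin 6) 3) : MvPolynomial (Set.powersetCard (Fin 6) 3) ℂ :=
      if nth S 0 = 0 then MvPolynomial.X S else MvPolynomial.C (θ S)
    have h0 : f.eval₂ MvPolynomial.C (cubicsProj MvPolynomial.C θ X') = 0 := by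
      apply MvPolynomial.funext
      intro x
      rw [MvPolynomial.eval₂_comp_left (MvPolynomial.eval x), map_zero]
      have h1 : (MvPolynomial.eval x).comp MvPolynomial.C = .id ℂ := by ext; simp
      have h2 : MvPolynomial.eval x ∘ cubicsProj MvPolynomial.C θ X' =
          cubicsProj (.id ℂ) θ (fun S => MvPolynomial.eval x (X' S)) := by
        funext S
        rw [Function.comp_apply, map_cubicsProj, h1]
      rw [h1, h2]
      exact mem_nVectorIdeal_iff.1 hf _ (cubicsProj_mem hθ fun S h => by simp [X', h])
    have h1 := congr_arg (MvPolynomial.eval₂Hom σ c) h0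
    rw [map_zero, MvPolynomial.eval₂_comp_left (MvPolynomial.eval₂Hom σ c)] at h1
    rw [← h1]
    have hC : (MvPolynomial.eval₂Hom σ c).comp MvPolynomial.C = σ := by ext; simp
    have hX : (fun S => MvPolynomial.eval₂Hom σ c (X' S)) = c := by
      funext S
      simp only [X']
      split_ifs with h
      · simp
      · simp [hc S h]
    rw [hC]
    congr 1
    funext S
    rw [Function.comp_apply, map_cubicsProj, hC, hX]
  -- Modulo the cubics, `c` and its projection agree, hence so do the values of `f`.
  rw [← sub_zero (f.eval₂ σ c), ← hproj, ← Ideal.Quotient.mk_eq_mk_iff_sub_mem,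
    MvPolynomial.eval₂_comp_left (Ideal.Quotient.mk I),
    MvPolynomial.eval₂_comp_left (Ideal.Quotient.mk I)]
  congr 1
  funext S
  rw [Function.comp_apply, Function.comp_apply, Ideal.Quotient.mk_eq_mk_iff_sub_mem]
  simp only [cubicsProj, sub_sub_cancel]
  exact Ideal.sum_mem _ fun i _ => Ideal.mul_mem_right _ _ (Ideal.subset_span ⟨i, rfl⟩)

/-! ### Invariance under changes of frame -/

/-- The minors of a matrix with rows `S` and columns `T`. -/
def minor {R : Type*} [CommRing R] (g : Fin 6 → Fin 6 → R) (S T : Set.powersetCard (Fin 6) 3) : R :=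
  (Matrix.of fun i j => g (nth S j) (nth T i)).det

theorem map_minor {R A : Type*} [CommRing R] [CommRing A] (σ : R →+* A) (g : Fin 6 → Fin 6 → R)
    (S T : Set.powersetCard (Fin 6) 3) : σ (minor g S T) = minor (fun i j => σ (g i j)) S T := by
  rw [minor, RingHom.map_det]; rfl

theorem exteriorPower_repr_eq_sum_minor {R M : Type*} [CommRing R] [AddCommGroup M] [Module R M]
    (b e : Module.Basis (Fin 6) R M) (y : ⋀[R]^3 M) (S : Set.powersetCard (Fin 6) 3) :
    (b.exteriorPower 3).repr y S =
      ∑ T, minor (fun i j => b.repr (e j) i) S T * (e.exteriorPower 3).repr y T := by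
  conv_lhs => rw [← (e.exteriorPower 3).sum_repr y]
  simp only [map_sum, map_smul, Finsupp.coe_finsetSum, Finset.sum_apply, Finsupp.coe_smul,
    Pi.smul_apply, smul_eq_mul]
  refine Finset.sum_congr rfl fun T _ => ?_
  rw [mul_comm, exteriorPower.basis_apply, exteriorPower.basis_repr_apply,
    exteriorPower.ιMulti_family, exteriorPower.ιMultiDual_apply_ιMulti]
  rfl

theorem coe_exteriorPower_map {R M N : Type*} [CommRing R] [AddCommGroup M] [Module R M]
    [AddCommGroup N] [Module R N] (n : ℕ) (g : M →ₗ[R] N) (y : ⋀[R]^n M) :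
    (exteriorPower.map n g y : ExteriorAlgebra R N) = ExteriorAlgebra.map g y := by
  have : (Submodule.subtype _).comp (exteriorPower.map n g) =
      (ExteriorAlgebra.map g).toLinearMap.comp (Submodule.subtype _) := by
    apply exteriorPower.linearMap_ext
    ext x
    simp [ExteriorAlgebra.map_apply_ιMulti]
  exact LinearMap.congr_fun this y

/-- Since `g (v ∧ ω) = g v ∧ g ω`, stability holds for every matrix, invertible or not; this allows
the entries of `g` to be treated as independent variables. -/
theorem minor_mulVec_mem_image (g : Fin 6 → Fin 6 → ℂ) {x : Set.powersetCard (Fin 6) 3 → ℂ}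
    (hx : x ∈ nVectorCoord '' partiallyDecomposable) :
    (fun S => ∑ T, minor g S T * x T) ∈ nVectorCoord '' partiallyDecomposable := by
  obtain ⟨y, ⟨v, ω, hy⟩, rfl⟩ := hx
  let l := Matrix.toLin' (Matrix.of g)
  refine ⟨exteriorPower.map 3 l y, ⟨l v, exteriorPower.map 2 l ω, ?_⟩, ?_⟩
  · rw [coe_exteriorPower_map, hy, map_mul, coe_exteriorPower_map, ExteriorAlgebra.map_apply_ι]
  · funext S
    conv_lhs => rw [← ((Pi.basisFun ℂ (Fin 6)).exteriorPower 3).sum_repr y]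
    rw [nVectorCoord]
    simp only [map_sum, map_smul, Finsupp.coe_finsetSum, Finset.sum_apply, Finsupp.coe_smul,
      Pi.smul_apply, smul_eq_mul]
    refine Finset.sum_congr rfl fun T _ => ?_
    rw [mul_comm, exteriorPower.basis_apply, exteriorPower.map_apply_ιMulti_family,
      exteriorPower.basis_repr_apply, exteriorPower.ιMulti_family,
      exteriorPower.ιMultiDual_apply_ιMulti]
    congr 2
    ext i j
    simp [l]

/-- The polynomial `f (g x)` in the entries of a matrix `g` and the coordinates `x`. -/
def genericTransform (f : MvPolynomial (Set.powersetCard (Fin 6) 3) ℂ) :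
    MvPolynomial (Fin 6 × Fin 6) (MvPolynomial (Set.powersetCard (Fin 6) 3) ℂ) :=
  f.eval₂ (MvPolynomial.C.comp MvPolynomial.C)
    (fun S => ∑ T, minor (fun i j => MvPolynomial.X (i, j)) S T * MvPolynomial.C (MvPolynomial.X T))

theorem eval₂_genericTransform (f : MvPolynomial (Set.powersetCard (Fin 6) 3) ℂ)
    {A : Type*} [CommRing A] (τ : ℂ →+* A) (g : Fin 6 → Fin 6 → A)
    (x : Set.powersetCard (Fin 6) 3 → A) :
    (genericTransform f).eval₂ (MvPolynomial.eval₂Hom τ x) (fun p => g p.1 p.2) =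
      f.eval₂ τ (fun S => ∑ T, minor g S T * x T) := by
  change MvPolynomial.eval₂Hom _ _ (genericTransform f) = _
  rw [genericTransform, MvPolynomial.eval₂_comp_left]
  congr 1
  · ext; simp
  · funext S
    rw [Function.comp_apply, map_sum]
    refine Finset.sum_congr rfl fun T _ => ?_
    rw [map_mul, map_minor]
    simp

/-- The ideal generated by the values of the equations of partially decomposable forms does not
depend on the frame. -/
theorem eval₂_repr_mem_span {R M : Type*} [CommRing R] [AddCommGroup M] [Module R M]
    (σ : ℂ →+* R) (b e : Module.Basis (Fin 6) R M) (y : ⋀[R]^3 M)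
    {f : MvPolynomial (Set.powersetCard (Fin 6) 3) ℂ}
    (hf : f ∈ nVectorIdeal partiallyDecomposable) :
    f.eval₂ σ ((b.exteriorPower 3).repr y) ∈ Ideal.span
      ((fun h : MvPolynomial (Set.powersetCard (Fin 6) 3) ℂ =>
        h.eval₂ σ ((e.exteriorPower 3).repr y)) '' nVectorIdeal partiallyDecomposable) := by
  -- For `x` in `Y` the polynomial `g ↦ f (g x)` vanishes at all matrices, so each of its
  -- coefficients, a polynomial in `x`, is an equation of `Y`. Thus `f (g x)` is a combination of
  -- equations at `x` with monomials in `g` as coefficients.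
  have hcoeff (d) : (genericTransform f).coeff d ∈ nVectorIdeal partiallyDecomposable := by
    rw [mem_nVectorIdeal_iff]
    intro x hx
    have h0 : MvPolynomial.map (MvPolynomial.eval₂Hom (.id ℂ) x) (genericTransform f) = 0 := by
      apply MvPolynomial.funext
      intro g
      rw [MvPolynomial.eval_map, map_zero]
      refine (eval₂_genericTransform f (.id ℂ) (fun i j => g (i, j)) x).trans ?_
      exact mem_nVectorIdeal_iff.1 hf _ (minor_mulVec_mem_image _ hx)
    simpa [MvPolynomial.coeff_map] using congr_arg (MvPolynomial.coeff d) h0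
  have key := eval₂_genericTransform f σ (fun i j => b.repr (e j) i) ((e.exteriorPower 3).repr y)
  have hb : (fun S => (b.exteriorPower 3).repr y S) = _ :=
    funext (exteriorPower_repr_eq_sum_minor b e y)
  rw [show ((b.exteriorPower 3).repr y : _ → R) = _ from hb, ← key, MvPolynomial.eval₂_eq]
  exact Ideal.sum_mem _ fun d _ => Ideal.mul_mem_right _ _
    (Ideal.subset_span ⟨_, hcoeff d, rfl⟩)

end PartiallyDecomposable

/-! ### Exterior powers of sheaves: local sections and morphisms out of them -/

namespace AlgebraicGeometry.Scheme.Modules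

variable {X : Scheme.{0}}

/-- The canonical map from the presheaf `U ↦ ⋀ⁿ_{𝒪(U)} M(U)` to the exterior power, as a map of
presheaves of modules. -/
def extPowerUnit (M : X.Modules) (n : ℕ) :
    exteriorPowerPresheaf M n ⟶
      (SheafOfModules.forget _ ⋙ PresheafOfModules.restrictScalars (𝟙 X.ringCatSheaf.obj)).obj
        (M.extPower n) :=
  (PresheafOfModules.sheafificationAdjunction (𝟙 X.ringCatSheaf.obj)).unit.app _

/-- `toExtPower` is defined through sheafification of abelian groups; linearity comes from its being
a component of the unit for sheaves of modules. -/
theorem toExtPower_smul (M : X.Modules) (n : ℕ) (U : X.Opens) (r : Γ(X, U))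
    (y : ⋀[Γ(X, U)]^n Γ(M, U)) :
    M.toExtPower n U (r • y) = r • M.toExtPower n U y :=
  ((extPowerUnit M n).app (op U)).hom.map_smul r y

theorem restrictSections_toExtPower (M : X.Modules) (n : ℕ) {U V : X.Opens} (h : V ≤ U)
    (y : ⋀[Γ(X, U)]^n Γ(M, U)) :
    (M.extPower n).restrictSections h (M.toExtPower n U y) =
      M.toExtPower n V (exteriorPowerMapSemilinear (M.restrictSections h) n y) :=
  (congr($((toSheafify (Opens.grothendieckTopology X) (exteriorPowerPresheafAb M n)).naturality
    (homOfLE h).op).hom y)).symm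

/-- The map from a presheaf to its sheafification is locally surjective. -/
theorem exists_restrictSections_eq_toExtPower (M : X.Modules) (n : ℕ) {U : X.Opens}
    (s : Γ(M.extPower n, U)) {x : X} (hx : x ∈ U) :
    ∃ (V : X.Opens) (h : V ≤ U) (y : ⋀[Γ(X, V)]^n Γ(M, V)), x ∈ V ∧
      (M.extPower n).restrictSections h s = M.toExtPower n V y := by
  have := Presheaf.imageSieve_mem (Opens.grothendieckTopology X)
    (toSheafify (Opens.grothendieckTopology X) (exteriorPowerPresheafAb M n)) s
  obtain ⟨V, f, ⟨y, hy⟩, hxV⟩ := this x hx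
  exact ⟨V, leOfHom f, y, hxV, hy.symm⟩

/-- A morphism of modules on sections. -/
def appLinear {M N : X.Modules} (φ : M ⟶ N) (U : X.Opens) : Γ(M, U) →ₗ[Γ(X, U)] Γ(N, U) where
  toFun := φ.app U
  map_add' x y := map_add _ x y
  map_smul' r x := φ.app_smul r x

theorem restrictSections_appLinear {M N : X.Modules} (φ : M ⟶ N) {U V : X.Opens} (h : V ≤ U)
    (m : Γ(M, U)) :
    N.restrictSections h (appLinear φ U m) = appLinear φ V (M.restrictSections h m) :=
  (congr($(φ.mapPresheaf.naturality (homOfLE h).op).hom m)).symm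

/-- The morphism out of an exterior power given by a compatible family of linear maps. -/
def extPowerDesc {M N : X.Modules} {n : ℕ}
    (g : ∀ U : X.Opens, ⋀[Γ(X, U)]^n Γ(M, U) →ₗ[Γ(X, U)] Γ(N, U))
    (hg : ∀ (U V : X.Opens) (h : V ≤ U) (y : ⋀[Γ(X, U)]^n Γ(M, U)),
      N.restrictSections h (g U y) =
        g V (exteriorPowerMapSemilinear (M.restrictSections h) n y)) :
    M.extPower n ⟶ N :=
  (PresheafOfModules.sheafificationHomEquiv (𝟙 X.ringCatSheaf.obj)).symm
    (PresheafOfModules.homMk (M₁ := exteriorPowerPresheaf M n)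
      (M₂ := (PresheafOfModules.restrictScalars (𝟙 X.ringCatSheaf.obj)).obj
        ((SheafOfModules.forget _).obj N))
      { app U := AddCommGrpCat.ofHom (g U.unop).toAddMonoidHom
        naturality U V f := by
          ext y
          exact (hg _ _ (leOfHom f.unop) y).symm }
      (fun U r m => (g U.unop).map_smul r m))

theorem extPowerDesc_toExtPower {M N : X.Modules} {n : ℕ}
    (g : ∀ U : X.Opens, ⋀[Γ(X, U)]^n Γ(M, U) →ₗ[Γ(X, U)] Γ(N, U))
    (hg : ∀ (U V : X.Opens) (h : V ≤ U) (y : ⋀[Γ(X, U)]^n Γ(M, U)),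
      N.restrictSections h (g U y) =
        g V (exteriorPowerMapSemilinear (M.restrictSections h) n y))
    (U : X.Opens) (y : ⋀[Γ(X, U)]^n Γ(M, U)) :
    appLinear (extPowerDesc g hg) U (M.toExtPower n U y) = g U y := by
  have h := PresheafOfModules.toPresheaf_map_sheafificationHomEquiv_def (𝟙 X.ringCatSheaf.obj)
    (extPowerDesc g hg)
  rw [extPowerDesc, Equiv.apply_symm_apply] at h
  exact (congr($(congr_app h (op U)).hom y)).symm

/-- A functional on a module, on sections. -/
def functional {M : X.Modules} (φ : M ⟶ structureSheaf X) (U : X.Opens) :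
    Γ(M, U) →ₗ[Γ(X, U)] Γ(X, U) :=
  appLinear φ U

theorem map_functional {M : X.Modules} (φ : M ⟶ structureSheaf X) {U V : X.Opens} (h : V ≤ U)
    (m : Γ(M, U)) :
    (X.presheaf.map (homOfLE h).op).hom (functional φ U m) =
      functional φ V (M.restrictSections h m) :=
  restrictSections_appLinear φ h m

/-- The alternating map `(m₀, m₁, m₂) ↦ ∑ sgn(σ) φ(m_{σ 1}) ψ(m_{σ 2}) χ(m_{σ 0})`, i.e. `χ ∧ φ ∧ ψ`. -/
def alternatingTriple {R M N : Type*} [CommRing R] [AddCommGroup M] [Module R M] [AddCommGroup N]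
    [Module R N] (χ : M →ₗ[R] N) (φ ψ : M →ₗ[R] R) : M [⋀^Fin 3]→ₗ[R] N where
  toFun m := (φ (m 1) * ψ (m 2) - φ (m 2) * ψ (m 1)) • χ (m 0)
    - (φ (m 0) * ψ (m 2) - φ (m 2) * ψ (m 0)) • χ (m 1)
    + (φ (m 0) * ψ (m 1) - φ (m 1) * ψ (m 0)) • χ (m 2)
  map_update_add' := by
    intro inst m i x y
    obtain rfl : inst = instDecidableEqFin 3 := Subsingleton.elim _ _
    fin_cases i <;> simp [Function.update] <;> module
  map_update_smul' := by
    intro inst m i c x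
    obtain rfl : inst = instDecidableEqFin 3 := Subsingleton.elim _ _
    fin_cases i <;> simp [Function.update] <;> module
  map_eq_zero_of_eq' m i j h hij := by
    fin_cases i <;> fin_cases j <;> first | exact absurd rfl hij | skip
    all_goals
      simp at h
      simp [h] <;> module

theorem alternatingTriple_apply {R M N : Type*} [CommRing R] [AddCommGroup M] [Module R M]
    [AddCommGroup N] [Module R N] (χ : M →ₗ[R] N) (φ ψ : M →ₗ[R] R) (m : Fin 3 → M) :
    alternatingTriple χ φ ψ m = (φ (m 1) * ψ (m 2) - φ (m 2) * ψ (m 1)) • χ (m 0)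
    - (φ (m 0) * ψ (m 2) - φ (m 2) * ψ (m 0)) • χ (m 1)
    + (φ (m 0) * ψ (m 1) - φ (m 1) * ψ (m 0)) • χ (m 2) :=
  rfl

/-- The morphism `⋀³ M ⟶ N` obtained from `χ : M ⟶ N` and two functionals `φ`, `ψ` on `M`. -/
def wedgeHom {M N : X.Modules} (χ : M ⟶ N) (φ ψ : M ⟶ structureSheaf X) : M.extPower 3 ⟶ N :=
  extPowerDesc (fun U => exteriorPower.alternatingMapLinearEquiv
      (alternatingTriple (appLinear χ U) (functional φ U) (functional ψ U))) (by
    intro U V h y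
    let φ₁ := (N.restrictSections h).comp (exteriorPower.alternatingMapLinearEquiv
      (alternatingTriple (appLinear χ U) (functional φ U) (functional ψ U)))
    let φ₂ := (exteriorPower.alternatingMapLinearEquiv
      (alternatingTriple (appLinear χ V) (functional φ V) (functional ψ V))).comp
        (exteriorPowerMapSemilinear (M.restrictSections h) 3)
    refine exteriorPower_semilinear_ext φ₁ φ₂ (fun m => ?_) y
    simp only [φ₁, φ₂, LinearMap.comp_apply, exteriorPower.alternatingMapLinearEquiv_apply_ιMulti,
      exteriorPowerMapSemilinear_ιMulti, alternatingTriple_apply, map_add, map_sub, map_smulₛₗ,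
      restrictSections_appLinear, map_mul,
      map_functional])

theorem wedgeHom_toExtPower {M N : X.Modules} (χ : M ⟶ N) (φ ψ : M ⟶ structureSheaf X)
    (U : X.Opens) (y : ⋀[Γ(X, U)]^3 Γ(M, U)) :
    appLinear (wedgeHom χ φ ψ) U (M.toExtPower 3 U y) =
      exteriorPower.alternatingMapLinearEquiv
        (alternatingTriple (appLinear χ U) (functional φ U) (functional ψ U)) y :=
  extPowerDesc_toExtPower _ _ _ _

/-- The coordinate at `S` is a determinant of three coordinate functions, expanded along the first
of them. This identifies the globally defined morphisms `wedgeHom` with coordinates in a local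
frame. -/
theorem alternatingTriple_repr {R M N : Type*} [CommRing R] [AddCommGroup M] [Module R M]
    [AddCommGroup N] [Module R N] (b : Module.Basis (Fin 6) R M) (S : Set.powersetCard (Fin 6) 3)
    (χ : M →ₗ[R] N) (φ ψ : M →ₗ[R] R) (r : N) (hχ : ∀ m, χ m = b.repr m (nth S 0) • r)
    (hφ : ∀ m, φ m = b.repr m (nth S 1)) (hψ : ∀ m, ψ m = b.repr m (nth S 2)) (y : ⋀[R]^3 M) :
    exteriorPower.alternatingMapLinearEquiv (alternatingTriple χ φ ψ) y =
      (b.exteriorPower 3).repr y S • r := by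
  have : exteriorPower.alternatingMapLinearEquiv (alternatingTriple χ φ ψ) =
      (exteriorPower.ιMultiDual R 3 b S).smulRight r := by
    apply exteriorPower.linearMap_ext
    ext m
    simp only [LinearMap.compAlternatingMap_apply, LinearMap.smulRight_apply,
      exteriorPower.alternatingMapLinearEquiv_apply_ιMulti, exteriorPower.ιMultiDual_apply_ιMulti,
      Matrix.det_fin_three, Matrix.of_apply, Module.Basis.coord_apply,
      alternatingTriple_apply, hχ, hφ, hψ]
    module
  rw [this, LinearMap.smulRight_apply, exteriorPower.basis_repr_apply]

/-! ### Frames -/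

theorem restrictSections_restrictSections {M : X.Modules} {U V W : X.Opens} (h : V ≤ U) (h' : W ≤ V)
    (m : Γ(M, U)) :
    M.restrictSections h' (M.restrictSections h m) = M.restrictSections (h'.trans h) m :=
  (congr($(M.presheaf.map_comp (homOfLE h).op (homOfLE h').op) m)).symm

theorem restrictSections_self {M : X.Modules} {U : X.Opens} (h : U ≤ U) (m : Γ(M, U)) :
    M.restrictSections h m = m :=
  congr($(M.presheaf.map_id (op U)) m)

namespace Frame

variable {M : X.Modules} {r : ℕ} {U V : X.Opens}

/-- The restriction of a frame to a smaller open subset. -/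
def restrict (b : M.Frame r U) (h : V ≤ U) : M.Frame r V where
  e i := M.restrictSections h (b.e i)
  bijective W hW := by
    simpa only [restrictSections_restrictSections] using b.bijective W (hW.trans h)

/-- A frame gives a basis of the module of sections. -/
def basis (b : M.Frame r U) : Module.Basis (Fin r) Γ(X, U) Γ(M, U) :=
  .ofEquivFun (LinearEquiv.ofBijective (Fintype.linearCombination Γ(X, U) b.e) (by
    have := b.bijective U le_rfl
    simp only [restrictSections_self] at this
    exact this)).symm

@[simp]
theorem basis_apply (b : M.Frame r U) (i : Fin r) : b.basis i = b.e i := by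
  simp only [basis, Module.Basis.coe_ofEquivFun, LinearEquiv.symm_symm]
  exact (Fintype.linearCombination_apply_single _ _ _ _).trans (one_smul _ _)

theorem coe_basis (b : M.Frame r U) : ⇑b.basis = b.e := funext b.basis_apply

theorem basis_repr_of_eq (b : M.Frame r U) {m : Γ(M, U)} {c : Fin r → Γ(X, U)}
    (h : m = ∑ i, c i • b.e i) : ⇑(b.basis.repr m) = c := by
  subst h
  simp_rw [← basis_apply]
  exact b.basis.repr_sum_self c

/-- A frame given by sections and coordinate functions. -/
def ofCoord (e : Fin r → Γ(M, U)) (q : ∀ V : X.Opens, V ≤ U → Γ(M, V) → Fin r → Γ(X, V))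
    (hq : ∀ V h (c : Fin r → Γ(X, V)), q V h (∑ i, c i • M.restrictSections h (e i)) = c)
    (hinj : ∀ V h, Function.Injective (q V h)) : M.Frame r U where
  e := e
  bijective V h := ⟨Function.LeftInverse.injective (g := q V h) (hq V h), fun m =>
    ⟨q V h m, hinj V h (hq V h _)⟩⟩

end Frame

/-! ### Sections of direct sums -/

@[simp]
theorem appLinear_add {M N : X.Modules} (φ ψ : M ⟶ N) (U : X.Opens) (m : Γ(M, U)) :
    appLinear (φ + ψ) U m = appLinear φ U m + appLinear ψ U m := rfl

@[simp]
theorem appLinear_zero {M N : X.Modules} (U : X.Opens) (m : Γ(M, U)) :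
    appLinear (0 : M ⟶ N) U m = 0 := rfl

@[simp]
theorem appLinear_comp {M N K : X.Modules} (φ : M ⟶ N) (ψ : N ⟶ K) (U : X.Opens) (m : Γ(M, U)) :
    appLinear (φ ≫ ψ) U m = appLinear ψ U (appLinear φ U m) := rfl

@[simp]
theorem appLinear_id {M : X.Modules} (U : X.Opens) (m : Γ(M, U)) : appLinear (𝟙 M) U m = m := rfl

theorem appLinear_sum {M N : X.Modules} {ι : Type*} (s : Finset ι) (φ : ι → (M ⟶ N))
    (U : X.Opens) (m : Γ(M, U)) :
    appLinear (∑ i ∈ s, φ i) U m = ∑ i ∈ s, appLinear (φ i) U m := by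
  classical
  induction s using Finset.induction_on with
  | empty => simp
  | insert a s ha ih => rw [Finset.sum_insert ha, Finset.sum_insert ha, appLinear_add, ih]

theorem eq_zero_of_biproduct_π {n : ℕ} (M : Fin n → X.Modules) {U : X.Opens} (m : Γ(⨁ M, U))
    (h : ∀ i, appLinear (biproduct.π M i) U m = 0) : m = 0 := by
  rw [← appLinear_id U m, ← biproduct.total, appLinear_sum]
  exact Finset.sum_eq_zero fun i _ => by rw [appLinear_comp, h i, map_zero]

theorem eq_zero_of_biprod (M N : X.Modules) {U : X.Opens} (m : Γ(M ⊞ N, U))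
    (h₁ : appLinear (biprod.fst : M ⊞ N ⟶ M) U m = 0)
    (h₂ : appLinear (biprod.snd : M ⊞ N ⟶ N) U m = 0) : m = 0 := by
  rw [← appLinear_id U m, ← biprod.total, appLinear_add, appLinear_comp, appLinear_comp, h₁, h₂,
    map_zero, map_zero, add_zero]

theorem appLinear_π_ι {n : ℕ} (M : Fin n → X.Modules) {U : X.Opens} (i : Fin n) (m : Γ(M i, U)) :
    appLinear (biproduct.π M i) U (appLinear (biproduct.ι M i) U m) = m := by
  rw [← appLinear_comp, biproduct.ι_π_self, appLinear_id]

theorem appLinear_π_ι_ne {n : ℕ} (M : Fin n → X.Modules) {U : X.Opens} {i j : Fin n} (h : i ≠ j)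
    (m : Γ(M i, U)) :
    appLinear (biproduct.π M j) U (appLinear (biproduct.ι M i) U m) = 0 := by
  rw [← appLinear_comp, biproduct.ι_π_ne _ h, appLinear_zero]

/-- The section `1` of the structure sheaf. -/
def oneSection (U : X.Opens) : Γ(structureSheaf X, U) := (1 : Γ(X, U))

theorem restrictSections_oneSection {U V : X.Opens} (h : V ≤ U) :
    (structureSheaf X).restrictSections h (oneSection U) = oneSection V :=
  map_one (X.presheaf.map (homOfLE h).op).hom

section Standard

variable (L : X.Modules)

/-- The bundle `L ⊕ 5 𝒪`. -/
abbrev sumTrivial : X.Modules := L ⊞ ⨁ fun _ : Fin 5 => structureSheaf X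

/-- The bundle `5 L`. -/
abbrev fiveCopies : X.Modules := ⨁ fun _ : Fin 5 => L

/-- The coordinates on the trivial summands of `L ⊕ 5 𝒪`, numbered from `1` to `5`. -/
def coordHom : Fin 6 → (sumTrivial L ⟶ structureSheaf X) :=
  Fin.cases 0 fun i => biprod.snd ≫ biproduct.π _ i

/-- The constant sections of the trivial summands of `L ⊕ 5 𝒪`. -/
def trivialSection (U : X.Opens) (i : Fin 5) : Γ(sumTrivial L, U) :=
  appLinear (biproduct.ι (fun _ : Fin 5 => structureSheaf X) i ≫ biprod.inr) U (oneSection U)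

variable {L} {U : X.Opens}

theorem restrictSections_trivialSection {V : X.Opens} (h : V ≤ U) (i : Fin 5) :
    (sumTrivial L).restrictSections h (trivialSection L U i) = trivialSection L V i := by
  rw [trivialSection, restrictSections_appLinear, restrictSections_oneSection, trivialSection]

theorem coordHom_trivialSection (i j : Fin 5) :
    functional (coordHom L i.succ) U (trivialSection L U j) = if i = j then 1 else 0 := by
  change appLinear (biprod.snd ≫ biproduct.π _ i) U (trivialSection L U j) = _
  rw [trivialSection, ← appLinear_comp, Category.assoc, biprod.inr_snd_assoc]
  split_ifs with h
  · subst h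
    rw [appLinear_comp, appLinear_π_ι]
    rfl
  · rw [appLinear_comp, appLinear_π_ι_ne _ (Ne.symm h)]
    rfl

theorem fst_trivialSection (j : Fin 5) :
    appLinear (biprod.fst : sumTrivial L ⟶ L) U (trivialSection L U j) = 0 := by
  rw [trivialSection, ← appLinear_comp, Category.assoc, biprod.inr_fst, comp_zero, appLinear_zero]

theorem coordHom_inl (i : Fin 5) (m : Γ(L, U)) :
    functional (coordHom L i.succ) U (appLinear biprod.inl U m) = 0 := by
  change appLinear (biprod.snd ≫ biproduct.π _ i) U (appLinear biprod.inl U m) = _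
  rw [← appLinear_comp, biprod.inl_snd_assoc, zero_comp]
  rfl

theorem fst_inl (m : Γ(L, U)) :
    appLinear (biprod.fst : sumTrivial L ⟶ L) U (appLinear biprod.inl U m) = m := by
  rw [← appLinear_comp, biprod.inl_fst, appLinear_id]

theorem eq_zero_of_coord (m : Γ(sumTrivial L, U))
    (h₁ : appLinear (biprod.fst : sumTrivial L ⟶ L) U m = 0)
    (h₂ : ∀ i : Fin 5, functional (coordHom L i.succ) U m = 0) : m = 0 :=
  eq_zero_of_biprod _ _ m h₁ (eq_zero_of_biproduct_π _ _ h₂)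

/-- The coordinate of a section of a line bundle in a frame. -/
def Frame.coord (l : L.Frame 1 U) {V : X.Opens} (h : V ≤ U) : Γ(L, V) →ₗ[Γ(X, V)] Γ(X, V) :=
  (l.restrict h).basis.coord 0

theorem Frame.coord_smul (l : L.Frame 1 U) {V : X.Opens} (h : V ≤ U) (m : Γ(L, V)) :
    l.coord h m • L.restrictSections h (l.e 0) = m := by
  have := (l.restrict h).basis.sum_repr m
  rwa [Fin.sum_univ_one, basis_apply] at this

theorem Frame.coord_self (l : L.Frame 1 U) {V : X.Opens} (h : V ≤ U) :
    l.coord h (L.restrictSections h (l.e 0)) = 1 := by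
  have : L.restrictSections h (l.e 0) = (l.restrict h).basis 0 := by
    rw [basis_apply]; rfl
  rw [coord, this, Module.Basis.coord_apply, Module.Basis.repr_self, Finsupp.single_eq_same]

/-- The frame of `L ⊕ 5 𝒪` given by a frame of `L`. -/
def Frame.sumTrivial (l : L.Frame 1 U) : (sumTrivial L).Frame 6 U :=
  .ofCoord (Fin.cons (appLinear biprod.inl U (l.e 0)) (trivialSection L U))
    (fun V h m => Fin.cons (l.coord h (appLinear biprod.fst V m))
      fun i => functional (coordHom L i.succ) V m)
    (fun V h c => by
      rw [Fin.sum_univ_succ]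
      simp only [Fin.cons_zero, Fin.cons_succ, restrictSections_trivialSection,
        restrictSections_appLinear]
      refine funext (Fin.cases ?_ fun i => ?_)
      · simp [fst_inl, fst_trivialSection, Frame.coord_self]
      · simp [coordHom_inl, coordHom_trivialSection])
    (fun V h m m' hm => by
      rw [← sub_eq_zero]
      apply eq_zero_of_coord
      · rw [map_sub, ← l.coord_smul h (appLinear _ V m), ← l.coord_smul h (appLinear _ V m'),
          show l.coord h (appLinear _ V m) = _ from congr_fun hm 0]
        simp
      · intro i
        rw [map_sub, sub_eq_zero]
        simpa using congr_fun hm i.succ)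

theorem Frame.sumTrivial_repr_succ (l : L.Frame 1 U) (m : Γ(Modules.sumTrivial L, U)) (i : Fin 6)
    (hi : i ≠ 0) : functional (coordHom L i) U m = l.sumTrivial.basis.repr m i := by
  obtain ⟨i, rfl⟩ := Fin.exists_succ_eq.2 hi
  conv_lhs => rw [← l.sumTrivial.basis.sum_repr m, Fin.sum_univ_succ]
  simp [Frame.sumTrivial, Frame.ofCoord, coordHom_inl, coordHom_trivialSection]

theorem Frame.sumTrivial_repr_zero (l : L.Frame 1 U) (m : Γ(Modules.sumTrivial L, U)) :
    appLinear biprod.fst U m = l.sumTrivial.basis.repr m 0 • l.e 0 := by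
  conv_lhs => rw [← l.sumTrivial.basis.sum_repr m, Fin.sum_univ_succ]
  simp [Frame.sumTrivial, Frame.ofCoord, fst_inl, fst_trivialSection]

/-- The frame of `5 L` given by a frame of `L`. -/
def Frame.fiveCopies (l : L.Frame 1 U) : (fiveCopies L).Frame 5 U :=
  .ofCoord (fun i => appLinear (biproduct.ι (fun _ => L) i) U (l.e 0))
    (fun V h m i => l.coord h (appLinear (biproduct.π (fun _ => L) i) V m))
    (fun V h c => by
      funext j
      rw [map_sum, Finset.sum_eq_single j]
      · rw [_root_.map_smul, restrictSections_appLinear, appLinear_π_ι, _root_.map_smul,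
          Frame.coord_self]
        simp
      · intro i _ hij
        rw [_root_.map_smul, restrictSections_appLinear, appLinear_π_ι_ne _ hij, smul_zero]
      · simp)
    (fun V h m m' hm => by
      rw [← sub_eq_zero]
      apply eq_zero_of_biproduct_π
      intro i
      rw [map_sub, ← l.coord_smul h (appLinear _ V m), ← l.coord_smul h (appLinear _ V m'),
        show l.coord h (appLinear _ V m) = _ from congr_fun hm i, sub_self])

end Standard

/-! ### The components of a section of `⋀³ (L ⊕ 5 𝒪)` -/

section Components

variable (π : X ⟶ Spec (.of ℂ)) (L : X.Modules)

theorem map_constants {U V : X.Opens} (h : V ≤ U) (z : ℂ) :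
    (X.presheaf.map (homOfLE h).op).hom (constants π U z) = constants π V z := by
  rw [constants, constants, RingHom.comp_apply, RingHom.comp_apply]
  exact congr($(X.presheaf.map_comp (homOfLE le_top).op (homOfLE h).op) _).symm

/-- Properness makes the global functions integral over `ℂ`; they form a domain, and `ℂ` is
algebraically closed. -/
theorem constants_bijective [IsIntegral X] [IsProper π] :
    Function.Bijective (constants π ⊤) := by
  have : constants π ⊤ = π.appTop.hom.comp (Scheme.ΓSpecIso (.of ℂ)).inv.hom := by
    ext z
    exact congr($(X.presheaf.map_id (op ⊤)) _)
  rw [this]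
  have hfin : (π.appTop.hom.comp (Scheme.ΓSpecIso (.of ℂ)).inv.hom).IsIntegral := by
    apply RingHom.isIntegral_respectsIso.2 (e := (Scheme.ΓSpecIso _).symm.commRingCatIsoToRingEquiv)
    exact isIntegral_appTop_of_universallyClosed π
  let _ := (π.appTop.hom.comp (Scheme.ΓSpecIso (.of ℂ)).inv.hom).toAlgebra
  have : Algebra.IsIntegral ℂ Γ(X, ⊤) := ⟨hfin⟩
  exact IsAlgClosed.algebraMap_bijective_of_isIntegral

/-- The component of type `⋀³ (5 𝒪)`. -/
def scalarHom (S : Set.powersetCard (Fin 6) 3) : (sumTrivial L).extPower 3 ⟶ structureSheaf X :=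
  wedgeHom (coordHom L (nth S 0)) (coordHom L (nth S 1)) (coordHom L (nth S 2))

/-- The component of type `L ⊗ ⋀² (5 𝒪)`. -/
def mixedHom (S : Set.powersetCard (Fin 6) 3) : (sumTrivial L).extPower 3 ⟶ L :=
  wedgeHom biprod.fst (coordHom L (nth S 1)) (coordHom L (nth S 2))

variable {L} in
-- The triple must avoid `0`: `coordHom` is zero at the index `0`, where the true coordinate takes
-- values in `L` and is only a function after a choice of frame.
theorem scalarHom_toExtPower {U : X.Opens} (l : L.Frame 1 U)
    (y : ⋀[Γ(X, U)]^3 Γ(sumTrivial L, U)) (S : Set.powersetCard (Fin 6) 3) (hS : nth S 0 ≠ 0) :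
    functional (scalarHom L S) U ((sumTrivial L).toExtPower 3 U y) =
      (l.sumTrivial.basis.exteriorPower 3).repr y S := by
  refine (wedgeHom_toExtPower _ _ _ _ _).trans
    ((alternatingTriple_repr l.sumTrivial.basis S _ _ _ (1 : Γ(X, U)) ?_ ?_ ?_ y).trans ?_)
  · intro m
    exact (l.sumTrivial_repr_succ m _ hS).trans (mul_one _).symm
  · exact fun m => l.sumTrivial_repr_succ m _ ((Fin.zero_le _).trans_lt (nth_lt S).1).ne'
  · exact fun m => l.sumTrivial_repr_succ m _ ((Fin.zero_le _).trans_lt (nth_lt S).2).ne'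
  · exact mul_one _

variable {L} in
theorem mixedHom_toExtPower {U : X.Opens} (l : L.Frame 1 U)
    (y : ⋀[Γ(X, U)]^3 Γ(sumTrivial L, U)) (S : Set.powersetCard (Fin 6) 3) (hS : nth S 0 = 0) :
    appLinear (mixedHom L S) U ((sumTrivial L).toExtPower 3 U y) =
      (l.sumTrivial.basis.exteriorPower 3).repr y S • l.e 0 := by
  refine (wedgeHom_toExtPower _ _ _ _ _).trans
    (alternatingTriple_repr l.sumTrivial.basis S _ _ _ (l.e 0) ?_ ?_ ?_ y)
  · intro m
    rw [hS]
    exact l.sumTrivial_repr_zero m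
  · exact fun m => l.sumTrivial_repr_succ m _ ((Fin.zero_le _).trans_lt (nth_lt S).1).ne'
  · exact fun m => l.sumTrivial_repr_succ m _ ((Fin.zero_le _).trans_lt (nth_lt S).2).ne'

end Components

theorem alternatingTriple_map {R M M' N : Type*} [CommRing R] [AddCommGroup M] [Module R M]
    [AddCommGroup M'] [Module R M'] [AddCommGroup N] [Module R N] (χ : M →ₗ[R] N)
    (φ ψ : M →ₗ[R] R) (h : M' →ₗ[R] M) (y : ⋀[R]^3 M') :
    exteriorPower.alternatingMapLinearEquiv (alternatingTriple χ φ ψ) (exteriorPower.map 3 h y) =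
      exteriorPower.alternatingMapLinearEquiv
        (alternatingTriple (χ.comp h) (φ.comp h) (ψ.comp h)) y := by
  have : (exteriorPower.alternatingMapLinearEquiv (alternatingTriple χ φ ψ)).comp
      (exteriorPower.map 3 h) = exteriorPower.alternatingMapLinearEquiv
        (alternatingTriple (χ.comp h) (φ.comp h) (ψ.comp h)) := by
    apply exteriorPower.linearMap_ext
    ext m
    simp only [LinearMap.compAlternatingMap_apply, LinearMap.comp_apply,
      exteriorPower.map_apply_ιMulti, exteriorPower.alternatingMapLinearEquiv_apply_ιMulti,
      alternatingTriple_apply, Function.comp_apply]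
  exact LinearMap.congr_fun this y

/-! ### Sections with prescribed components -/

section BuildSections

variable {L : X.Modules} {U : X.Opens}

/-- The map `𝒪(U)⁶ → (L ⊕ 5 𝒪)(U)` given by a section of `L` and the trivial sections. -/
def sectionMap (m : Γ(L, U)) : (Fin 6 → Γ(X, U)) →ₗ[Γ(X, U)] Γ(sumTrivial L, U) :=
  Fintype.linearCombination _ (Fin.cons (appLinear biprod.inl U m) (trivialSection L U))

theorem functional_sectionMap (m : Γ(L, U)) (v : Fin 6 → Γ(X, U)) {i : Fin 6} (hi : i ≠ 0) :
    functional (coordHom L i) U (sectionMap m v) = v i := by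
  obtain ⟨i, rfl⟩ := Fin.exists_succ_eq.2 hi
  rw [sectionMap, Fintype.linearCombination_apply, Fin.sum_univ_succ]
  simp [coordHom_inl, coordHom_trivialSection]

theorem fst_sectionMap (m : Γ(L, U)) (v : Fin 6 → Γ(X, U)) :
    appLinear biprod.fst U (sectionMap m v) = v 0 • m := by
  rw [sectionMap, Fintype.linearCombination_apply, Fin.sum_univ_succ]
  simp [fst_inl, fst_trivialSection]

/-- The section of `⋀³ (L ⊕ 5 𝒪)` whose only component is the one of index `T`. -/
def monomialSection (m : Γ(L, U)) (T : Set.powersetCard (Fin 6) 3) :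
    Γ((sumTrivial L).extPower 3, U) :=
  (sumTrivial L).toExtPower 3 U (exteriorPower.map 3 (sectionMap m)
    (exteriorPower.ιMulti_family _ 3 (Pi.basisFun Γ(X, U) (Fin 6)) T))

theorem scalarHom_monomialSection (m : Γ(L, U)) (S T : Set.powersetCard (Fin 6) 3)
    (hS : nth S 0 ≠ 0) :
    functional (scalarHom L S) U (monomialSection m T) = if S = T then 1 else 0 := by
  refine (wedgeHom_toExtPower _ _ _ _ _).trans ((alternatingTriple_map _ _ _ _ _).trans
    ((alternatingTriple_repr (Pi.basisFun Γ(X, U) (Fin 6)) S _ _ _ (1 : Γ(X, U)) ?_ ?_ ?_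
      _).trans ?_))
  · exact fun v => (functional_sectionMap m v hS).trans (mul_one _).symm
  · exact fun v => functional_sectionMap m v ((Fin.zero_le _).trans_lt (nth_lt S).1).ne'
  · exact fun v => functional_sectionMap m v ((Fin.zero_le _).trans_lt (nth_lt S).2).ne'
  · rw [exteriorPower.basis_repr, smul_eq_mul, mul_one, Finsupp.single_apply]
    simp only [eq_comm]

theorem mixedHom_monomialSection (m : Γ(L, U)) (S T : Set.powersetCard (Fin 6) 3)
    (hS : nth S 0 = 0) :
    appLinear (mixedHom L S) U (monomialSection m T) = if S = T then m else 0 := by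
  refine (wedgeHom_toExtPower _ _ _ _ _).trans ((alternatingTriple_map _ _ _ _ _).trans
    ((alternatingTriple_repr (Pi.basisFun Γ(X, U) (Fin 6)) S _ _ _ m ?_ ?_ ?_ _).trans ?_))
  · intro v
    rw [hS]
    exact fst_sectionMap m v
  · exact fun v => functional_sectionMap m v ((Fin.zero_le _).trans_lt (nth_lt S).1).ne'
  · exact fun v => functional_sectionMap m v ((Fin.zero_le _).trans_lt (nth_lt S).2).ne'
  · rw [exteriorPower.basis_repr, Finsupp.single_apply, ite_smul, one_smul, zero_smul]
    simp only [eq_comm]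

end BuildSections

/-! ### Global sections and the map to sections of `5 L` -/

section Global

variable (π : X ⟶ Spec (.of ℂ))

/-- A morphism of modules on global sections, as a map of complex vector spaces. -/
def H0.map {M N : X.Modules} (φ : M ⟶ N) : H0 π M →ₗ[ℂ] H0 π N where
  toFun := appLinear φ ⊤
  map_add' x y := map_add (appLinear φ ⊤) x y
  map_smul' z x := (appLinear φ ⊤).map_smul (constants π ⊤ z) x

/-- Restriction of global sections, as a semilinear map. -/
def H0.restrictLinear (M : X.Modules) (U : X.Opens) : H0 π M →ₛₗ[constants π U] Γ(M, U) where
  toFun s := s.restrict U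
  map_add' x y := map_add (M.restrictSections le_top) x y
  map_smul' z x := by
    rw [← map_constants π (le_top : U ≤ ⊤) z]
    exact (M.restrictSections le_top).map_smulₛₗ (constants π ⊤ z) x

variable {π}

theorem H0.restrict_map {M N : X.Modules} (φ : M ⟶ N) (s : H0 π M) (U : X.Opens) :
    (H0.map π φ s).restrict U = appLinear φ U (s.restrict U) :=
  restrictSections_appLinear φ le_top s

theorem H0.restrictSections_restrict {M : X.Modules} (s : H0 π M) {U V : X.Opens} (h : V ≤ U) :
    M.restrictSections h (s.restrict U) = s.restrict V :=
  restrictSections_restrictSections _ _ _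

theorem H0.sum_ι_π {L : X.Modules} (t : H0 π (fiveCopies L)) :
    ∑ i, H0.map π (biproduct.ι (fun _ : Fin 5 => L) i)
      (H0.map π (biproduct.π (fun _ : Fin 5 => L) i) t) = t := by
  have := appLinear_sum Finset.univ (fun i => biproduct.π (fun _ : Fin 5 => L) i ≫
    biproduct.ι (fun _ : Fin 5 => L) i) ⊤ t
  rw [biproduct.total] at this
  exact this.symm

/-- The components of a section of `⋀³ (L ⊕ 5 𝒪)` with values in `L`. -/
def mixedPart (π : X ⟶ Spec (.of ℂ)) (L : X.Modules) (S : Set.powersetCard (Fin 6) 3) :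
    H0 π ((sumTrivial L).extPower 3) →ₗ[ℂ] H0 π L :=
  H0.map π (mixedHom L S)

theorem mixedPart_eq {L : X.Modules} {V : X.Opens} (l : L.Frame 1 V)
    (s : H0 π ((sumTrivial L).extPower 3))
    (y : ⋀[Γ(X, V)]^3 Γ(sumTrivial L, V)) (hy : s.restrict V = (sumTrivial L).toExtPower 3 V y)
    (S : Set.powersetCard (Fin 6) 3) (hS : nth S 0 = 0) :
    (mixedPart π L S s).restrict V = (l.sumTrivial.basis.exteriorPower 3).repr y S • l.e 0 := by
  rw [← mixedHom_toExtPower l y S hS, ← hy]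
  exact H0.restrict_map (mixedHom L S) s V

variable (π) [IsIntegral X] [IsProper π]

/-- The global functions on an integral proper complex scheme are the complex numbers. -/
def constantsEquiv : ℂ ≃+* Γ(X, ⊤) := .ofBijective (constants π ⊤) (constants_bijective π)

/-- The value of a global function on an integral proper complex scheme. -/
def H0.value : H0 π (structureSheaf X) →ₗ[ℂ] ℂ where
  toFun := (constantsEquiv π).symm
  map_add' x y := map_add (constantsEquiv π).symm x y
  map_smul' z x := by
    refine ((constantsEquiv π).symm.map_mul (constants π ⊤ z) x).trans ?_
    congr 1
    exact (constantsEquiv π).symm_apply_apply z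

variable {π} in
theorem H0.restrict_eq_constants (f : H0 π (structureSheaf X)) (U : X.Opens) :
    f.restrict U = constants π U (H0.value π f) := by
  rw [← map_constants π (le_top : U ≤ ⊤)]
  congr 1
  exact ((constantsEquiv π).apply_symm_apply f).symm

variable (L : X.Modules)

/-- The scalar components of a section of `⋀³ (L ⊕ 5 𝒪)`. -/
def scalarPart (S : Set.powersetCard (Fin 6) 3) : H0 π ((sumTrivial L).extPower 3) →ₗ[ℂ] ℂ :=
  (H0.value π).comp (H0.map π (scalarHom L S))

theorem exists_section_of_parts (c : Set.powersetCard (Fin 6) 3 → ℂ)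
    (m : Set.powersetCard (Fin 6) 3 → H0 π L) :
    ∃ s, (∀ S, nth S 0 ≠ 0 → scalarPart π L S s = c S) ∧
      ∀ S, nth S 0 = 0 → mixedPart π L S s = m S := by
  -- For triples containing `0` the prescribed value already sits in the section `m T`; for the
  -- others it enters as a scalar.
  let z (T : Set.powersetCard (Fin 6) 3) : ℂ := if nth T 0 = 0 then 1 else c T
  let t (T : Set.powersetCard (Fin 6) 3) : H0 π ((sumTrivial L).extPower 3) :=
    monomialSection (U := ⊤) (m T) T
  refine ⟨∑ T, z T • t T, fun S hS => ?_, fun S hS => ?_⟩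
  · have h (T) : scalarPart π L S (t T) = if S = T then 1 else 0 := by
      refine (congr_arg (constantsEquiv π).symm
        (scalarHom_monomialSection (U := ⊤) (m T) S T hS)).trans ?_
      split_ifs
      · exact map_one _
      · exact map_zero _
    simp only [map_sum, _root_.map_smul, h, smul_eq_mul, mul_ite, mul_one, mul_zero,
      Finset.sum_ite_eq, Finset.mem_univ, if_true]
    simp [z, hS]
  · have h (T) : mixedPart π L S (t T) = if S = T then m T else 0 :=
      mixedHom_monomialSection (U := ⊤) (m T) S T hS
    simp only [map_sum, _root_.map_smul, h, smul_ite, smul_zero, Finset.sum_ite_eq,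
      Finset.mem_univ, if_true]
    simp [z, hS]

/-- The section of `5 L` attached to a section of `⋀³ (L ⊕ 5 𝒪)`. -/
def cubicSection (s : H0 π ((sumTrivial L).extPower 3)) : H0 π (fiveCopies L) :=
  ∑ i, H0.map π (biproduct.ι (fun _ : Fin 5 => L) i)
    (cubics (fun S => scalarPart π L S s) (fun S => mixedPart π L S s) i)

/-- Fix the scalar part to be a good form and solve the linear system for the `L`-valued part. -/
theorem exists_cubicSection_eq {c : Set.powersetCard (Fin 6) 3 → ℂ} (hc : IsGood c)
    (t : H0 π (fiveCopies L)) : ∃ s, cubicSection π L s = t := by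
  obtain ⟨s, h₁, h₂⟩ := exists_section_of_parts π L c
    (cubicsSection c fun i => H0.map π (biproduct.π (fun _ : Fin 5 => L) i) t)
  refine ⟨s, ?_⟩
  rw [cubicSection, cubics_congr h₁ h₂, cubics_cubicsSection hc, H0.sum_ι_π]

variable {L} {π}

theorem scalarPart_eq {V : X.Opens} (l : L.Frame 1 V) (s : H0 π ((sumTrivial L).extPower 3))
    (y : ⋀[Γ(X, V)]^3 Γ(sumTrivial L, V)) (hy : s.restrict V = (sumTrivial L).toExtPower 3 V y)
    (S : Set.powersetCard (Fin 6) 3) (hS : nth S 0 ≠ 0) :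
    (l.sumTrivial.basis.exteriorPower 3).repr y S = constants π V (scalarPart π L S s) := by
  rw [← scalarHom_toExtPower l y S hS, ← hy]
  exact (H0.restrict_map (scalarHom L S) s V).symm.trans (H0.restrict_eq_constants _ V)

/-- The mixed components are multiples of the generator `l.e 0`, the scalar ones are constants, and
the cubics are linear in the former, so the generator factors out. -/
theorem cubicSection_restrict {V : X.Opens} (l : L.Frame 1 V)
    (s : H0 π ((sumTrivial L).extPower 3)) (y : ⋀[Γ(X, V)]^3 Γ(sumTrivial L, V))
    (hy : s.restrict V = (sumTrivial L).toExtPower 3 V y) :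
    (cubicSection π L s).restrict V =
      ∑ i, cubics ((l.sumTrivial.basis.exteriorPower 3).repr y)
        ((l.sumTrivial.basis.exteriorPower 3).repr y) i • l.fiveCopies.e i := by
  set c : Set.powersetCard (Fin 6) 3 → Γ(X, V) := ⇑((l.sumTrivial.basis.exteriorPower 3).repr y)
  change H0.restrictLinear π _ V _ = _
  rw [cubicSection, map_sum]
  refine Finset.sum_congr rfl fun i _ => (H0.restrict_map _ _ V).trans ?_
  have h : (cubics (fun S => scalarPart π L S s) (fun S => mixedPart π L S s) i).restrict V =
      cubics c c i • l.e 0 := by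
    refine (map_cubics (H0.restrictLinear π L V) _ _ i).trans ?_
    have h₁ := map_cubics (LinearMap.toSpanSingleton Γ(X, V) Γ(L, V) (l.e 0)) c c i
    rw [LinearMap.toSpanSingleton_apply] at h₁
    rw [h₁]
    refine congr_fun (cubics_congr (fun S hS => ?_) fun S hS => ?_) i
    · exact (scalarPart_eq l s y hy S hS).symm
    · exact mixedPart_eq l s y hy S hS
  rw [h, LinearMap.map_smul]
  rfl

end Global

/-! ### Comparison of the two ideal sheaves -/

theorem mem_ideal_of_locally (I : X.IdealSheafData) (U : X.affineOpens) (f : Γ(X, U))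
    (h : ∀ x ∈ U.1, ∃ (V : X.affineOpens) (hVU : V.1 ≤ U.1), x ∈ V.1 ∧
      (X.presheaf.map (homOfLE hVU).op).hom f ∈ I.ideal V) : f ∈ I.ideal U := by
  refine U.2.mem_ideal_iff.2 fun x hx => ?_
  obtain ⟨V, hVU, hxV, hf⟩ := h x hx
  rw [← I.map_ideal (U := V) (V := U) hVU] at hf
  have := Ideal.mem_map_of_mem (X.presheaf.germ V.1 x hxV).hom hf
  have hres : X.presheaf.map (homOfLE hVU).op ≫ X.presheaf.germ V.1 x hxV =
      X.presheaf.germ U.1 x hx := X.presheaf.germ_res (homOfLE hVU) x hxV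
  have hres' : (X.presheaf.germ V.1 x hxV).hom.comp (X.presheaf.map (homOfLE hVU).op).hom =
      (X.presheaf.germ U.1 x hx).hom := congr_arg CommRingCat.Hom.hom hres
  have hmap : ((I.ideal U).map (X.presheaf.map (homOfLE hVU).op).hom).map
      (X.presheaf.germ V.1 x hxV).hom = (I.ideal U).map (X.presheaf.germ U.1 x hx).hom := by
    rw [Ideal.map_map, hres']
  have := hmap.le this
  exact (congr($hres' f) : _ = _) ▸ this

theorem exists_affine_frame {L : X.Modules} (hL : L.IsVectorBundle 1) {U : X.Opens} {x : X}
    (hx : x ∈ U) : ∃ V : X.affineOpens, V.1 ≤ U ∧ x ∈ V.1 ∧ Nonempty (L.Frame 1 V.1) := by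
  obtain ⟨W, hxW, ⟨l⟩⟩ := hL x
  obtain ⟨V, hV, hxV, hVW⟩ := exists_isAffineOpen_mem_and_subset (x := x) (U := U ⊓ W) ⟨hx, hxW⟩
  exact ⟨⟨V, hV⟩, hVW.trans inf_le_left, hxV, ⟨l.restrict (hVW.trans inf_le_right)⟩⟩

theorem sum_smul_toExtPower {M : X.Modules} {r n : ℕ} {U : X.Opens}
    (c : Set.powersetCard (Fin r) n → Γ(X, U)) (e : Fin r → Γ(M, U)) :
    ∑ S, c S • M.toExtPower n U (exteriorPower.ιMulti_family Γ(X, U) n e S) =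
      M.toExtPower n U (∑ S, c S • exteriorPower.ιMulti_family Γ(X, U) n e S) := by
  rw [map_sum]
  simp only [toExtPower_smul]

theorem exteriorPowerMapSemilinear_sum {M : X.Modules} {r n : ℕ} {U V : X.Opens} (h : V ≤ U)
    (b : M.Frame r U) (c : Set.powersetCard (Fin r) n → Γ(X, U)) :
    exteriorPowerMapSemilinear (M.restrictSections h) n
        (∑ S, c S • exteriorPower.ιMulti_family Γ(X, U) n b.e S) =
      ∑ S, (X.presheaf.map (homOfLE h).op).hom (c S) •
        exteriorPower.ιMulti_family Γ(X, V) n (b.restrict h).e S := by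
  rw [map_sum]
  simp only [map_smulₛₗ, exteriorPower.ιMulti_family, exteriorPowerMapSemilinear_ιMulti]
  rfl

section Main

variable {π : X ⟶ Spec (.of ℂ)} [IsIntegral X] [IsProper π] {L : X.Modules}

theorem degeneracyLocus_eq_zeroLocus (hL : L.IsVectorBundle 1)
    (s : H0 π ((sumTrivial L).extPower 3)) (hs : IsGood fun S => scalarPart π L S s) :
    degeneracyLocus partiallyDecomposable s = zeroLocus 5 (cubicSection π L s) := by
  rw [degeneracyLocus, zeroLocus]
  -- Both ideal sheaves are infima, so it suffices that an ideal sheaf `I` satisfies one set of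
  -- conditions exactly when it satisfies the other.
  congr 1
  ext I
  constructor
  · intro hI U b c hc i
    apply mem_ideal_of_locally
    intro x hx
    obtain ⟨W, hWU, y, hxW, hy⟩ := exists_restrictSections_eq_toExtPower _ _ (s.restrict U) hx
    obtain ⟨V, hVW, hxV, ⟨l⟩⟩ := exists_affine_frame hL hxW
    have hVU : V.1 ≤ U.1 := hVW.trans hWU
    refine ⟨V, hVU, hxV, ?_⟩
    rw [H0.restrictSections_restrict] at hy
    have hy' := congr_arg (((sumTrivial L).extPower 3).restrictSections hVW) hy
    rw [H0.restrictSections_restrict, restrictSections_toExtPower] at hy'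
    set y' := exteriorPowerMapSemilinear ((sumTrivial L).restrictSections hVW) 3 y
    have h₁ := hI V l.sumTrivial ((l.sumTrivial.basis.exteriorPower 3).repr y') (by
      rw [sum_smul_toExtPower, hy', ← Frame.coe_basis]
      congr 1
      simp_rw [← exteriorPower.basis_apply]
      exact ((l.sumTrivial.basis.exteriorPower 3).sum_repr y').symm)
    have h₂ (j : Fin 5) := h₁ (cubicPoly j) (cubicPoly_mem j)
    simp only [eval₂_cubicPoly] at h₂
    have h₃ := congr_arg ((fiveCopies L).restrictSections hVU) hc
    rw [H0.restrictSections_restrict, map_sum] at h₃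
    simp only [map_smulₛₗ] at h₃
    -- Coordinates in the arbitrary frame `b` are linear combinations of those in the frame induced
    -- by `l`, which are the cubics.
    rw [← congr_fun ((b.restrict hVU).basis_repr_of_eq h₃) i, cubicSection_restrict l s y' hy',
      map_sum, Finsupp.coe_finsetSum, Finset.sum_apply]
    refine Ideal.sum_mem _ fun j _ => ?_
    rw [LinearEquiv.map_smul]
    exact Ideal.mul_mem_right _ _ (h₂ j)
  · intro hI U b c hc f hf
    apply mem_ideal_of_locally
    intro x hx
    obtain ⟨V, hVU, hxV, ⟨l⟩⟩ := exists_affine_frame hL hx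
    refine ⟨V, hVU, hxV, ?_⟩
    have hy := congr_arg (((sumTrivial L).extPower 3).restrictSections hVU) hc
    rw [H0.restrictSections_restrict, sum_smul_toExtPower, restrictSections_toExtPower,
      exteriorPowerMapSemilinear_sum] at hy
    set y := ∑ S, (X.presheaf.map (homOfLE hVU).op).hom (c S) •
        exteriorPower.ιMulti_family Γ(X, V.1) 3 (b.restrict hVU).e S with hydef
    have hrepr : (((b.restrict hVU).basis.exteriorPower 3).repr y : _ → Γ(X, V.1)) =
        fun S => (X.presheaf.map (homOfLE hVU).op).hom (c S) := by
      rw [hydef, ← Frame.coe_basis]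
      simp_rw [← exteriorPower.basis_apply]
      exact ((b.restrict hVU).basis.exteriorPower 3).repr_sum_self _
    have h₁ := hI V l.fiveCopies _ (cubicSection_restrict l s y hy)
    have h₂ : Ideal.span (Set.range (cubics ((l.sumTrivial.basis.exteriorPower 3).repr y)
        ((l.sumTrivial.basis.exteriorPower 3).repr y))) ≤ I.ideal V := by
      rw [Ideal.span_le]
      rintro _ ⟨i, rfl⟩
      exact h₁ i
    -- Passing to the frame induced by `l` is essential: only there is the part of `s` without the
    -- index `0` constant and good.
    have h₃ := eval₂_repr_mem_span (constants π V) (b.restrict hVU).basis l.sumTrivial.basis y hf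
    rw [hrepr] at h₃
    rw [MvPolynomial.eval₂_comp_left (X.presheaf.map (homOfLE hVU).op).hom]
    have h₄ : (X.presheaf.map (homOfLE hVU).op).hom.comp (constants π U) = constants π V :=
      RingHom.ext (map_constants π hVU)
    rw [h₄]
    refine (Ideal.span_le.2 ?_) h₃
    rintro _ ⟨g, hg, rfl⟩
    exact h₂ (eval₂_mem_span_cubics (constants π V) hs _ (scalarPart_eq l s y hy) hg)

end Main

end AlgebraicGeometry.Scheme.Modules

/-! ### General sections -/

theorem exists_isGood : ∃ c : Set.powersetCard (Fin 6) 3 → ℂ, IsGood c := by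
  have h (i j k : Fin 6) (hij : i < j) (hjk : j < k) (S : Set.powersetCard (Fin 6) 3) :
      triple i j k hij hjk = S ↔ i = nth S 0 ∧ j = nth S 1 ∧ k = nth S 2 := by
    constructor
    · rintro rfl; simp
    · rintro ⟨rfl, rfl, rfl⟩; exact triple_nth S
  -- The form `e₁ ∧ (e₂ ∧ e₃ + e₄ ∧ e₅)`, whose first Pfaffian is `1`.
  refine ⟨fun S => if S = triple 1 2 3 ∨ S = triple 1 4 5 then 1 else 0, ?_⟩
  simp [IsGood, pfaffianVector, h]

theorem cubics_mem {A : Type*} [CommRing A] [Algebra ℂ A] (B : Subalgebra ℂ A)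
    {θ m : Set.powersetCard (Fin 6) 3 → A} (hθ : ∀ S, θ S ∈ B) (hm : ∀ S, m S ∈ B) (i : Fin 5) :
    cubics θ m i ∈ B := by
  have := map_cubics (R := B) (M := B) (N := A) (σ := (B.val : B →+* A))
    (B.val : B →+* A).toSemilinearMap (fun S => ⟨θ S, hθ S⟩) (fun S => ⟨m S, hm S⟩) i
  change _ = cubics θ m i at this
  rw [← this]
  exact Subtype.property _

theorem cubics_apply {W R : Type*} [CommRing R] (θ m : Set.powersetCard (Fin 6) 3 → W → R)
    (i : Fin 5) (w : W) :
    cubics θ m i w = cubics (fun S => θ S w) (fun S => m S w) i :=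
  map_cubics (R := W → R) (M := W → R) (N := R) (σ := Pi.evalRingHom (fun _ => R) w)
    (Pi.evalRingHom (fun _ => R) w).toSemilinearMap θ m i

theorem linear_mem_polyFunctions {W : Type*} [AddCommGroup W] [Module ℂ W] (l : W →ₗ[ℂ] ℂ) :
    (fun w => l w) ∈ polyFunctions W :=
  Algebra.subset_adjoin ⟨l, rfl⟩

/-- Composition with a map whose composites with linear forms are polynomial preserves polynomial
functions. -/
theorem comp_mem_polyFunctions {W W' : Type*} [AddCommGroup W] [Module ℂ W] [AddCommGroup W']
    [Module ℂ W'] (T : W → W') (hT : ∀ l : W' →ₗ[ℂ] ℂ, (fun w => l (T w)) ∈ polyFunctions W)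
    {p : W' → ℂ} (hp : p ∈ polyFunctions W') : p ∘ T ∈ polyFunctions W := by
  let F : (W' → ℂ) →ₐ[ℂ] (W → ℂ) :=
    { toFun := fun p => p ∘ T
      map_one' := rfl
      map_mul' := fun _ _ => rfl
      map_zero' := rfl
      map_add' := fun _ _ => rfl
      commutes' := fun _ => rfl }
  have : polyFunctions W' ≤ (polyFunctions W).comap F := by
    rw [polyFunctions, Algebra.adjoin_le_iff]
    rintro _ ⟨l, rfl⟩
    exact hT l
  exact this hp

namespace AlgebraicGeometry.Scheme.Modules

variable {X : Scheme.{0}} (π : X ⟶ Spec (.of ℂ)) [IsIntegral X] [IsProper π] (L : X.Modules)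

/-- Linearity of the cubics in `m` lets `l` move inside, leaving cubic expressions in linear forms
on the space of sections. -/
theorem cubicSection_polynomial (l : H0 π (fiveCopies L) →ₗ[ℂ] ℂ) :
    (fun s => l (cubicSection π L s)) ∈ polyFunctions (H0 π ((sumTrivial L).extPower 3)) := by
  have h : (fun s => l (cubicSection π L s)) =
      ∑ i, cubics (fun S s => scalarPart π L S s) (fun S s =>
        l (H0.map π (biproduct.ι (fun _ : Fin 5 => L) i) (mixedPart π L S s))) i := by
    funext s
    rw [Finset.sum_apply, cubicSection, map_sum]
    refine Finset.sum_congr rfl fun i _ => ?_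
    refine (map_cubics (l.comp (H0.map π (biproduct.ι (fun _ : Fin 5 => L) i))) _ _ i).trans ?_
    rw [cubics_apply]
    rfl
  rw [h]
  exact sum_mem fun i _ => cubics_mem _ (fun S => linear_mem_polyFunctions (scalarPart π L S))
    (fun S => linear_mem_polyFunctions
      (l.comp ((H0.map π (biproduct.ι (fun _ : Fin 5 => L) i)).comp (mixedPart π L S)))) i

theorem holdsForGeneral_isGood :
    HoldsForGeneral fun s : H0 π ((sumTrivial L).extPower 3) =>
      IsGood fun S => scalarPart π L S s := by
  let θ (S : Set.powersetCard (Fin 6) 3) (s : H0 π ((sumTrivial L).extPower 3)) : ℂ :=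
    scalarPart π L S s
  have hθ (S) : θ S ∈ polyFunctions (H0 π ((sumTrivial L).extPower 3)) :=
    linear_mem_polyFunctions (scalarPart π L S)
  let p := θ (triple 1 2 3) * pfaffianVector θ 1
  have hp : p ∈ polyFunctions (H0 π ((sumTrivial L).extPower 3)) :=
    mul_mem (hθ _) (add_mem (sub_mem (mul_mem (hθ _) (hθ _)) (mul_mem (hθ _) (hθ _)))
      (mul_mem (hθ _) (hθ _)))
  have hgood (s) : p s ≠ 0 ↔ IsGood fun S => scalarPart π L S s := Iff.rfl
  refine ⟨{s | p s ≠ 0}, ⟨{p}, by simpa using hp, by simp⟩, ?_, fun s hs => (hgood s).1 hs⟩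
  obtain ⟨c, hc⟩ := exists_isGood
  obtain ⟨s, hs, -⟩ := exists_section_of_parts π L c 0
  have h (i j k : Fin 6) (hij : i < j) (hjk : j < k) (hi : i ≠ 0) :
      scalarPart π L (triple i j k hij hjk) s = c (triple i j k hij hjk) :=
    hs _ (by simpa using hi)
  refine ⟨s, (hgood s).2 ?_⟩
  simpa [IsGood, pfaffianVector, h] using hc

/-- The open set is pulled back along a polynomial map; surjectivity keeps the preimage non-empty.
-/
theorem holdsForGeneral_cubicSection {P : H0 π (fiveCopies L) → Prop} (hP : HoldsForGeneral P) :
    HoldsForGeneral fun s => P (cubicSection π L s) := by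
  obtain ⟨U, ⟨A, hA, rfl⟩, ⟨t, p, hp, hpt⟩, hU⟩ := hP
  refine ⟨{s | ∃ q ∈ (fun p : _ → ℂ => p ∘ cubicSection π L) '' A, q s ≠ 0}, ⟨_, ?_, rfl⟩, ?_, ?_⟩
  · rintro _ ⟨q, hq, rfl⟩
    exact comp_mem_polyFunctions _ (cubicSection_polynomial π L) (hA hq)
  · obtain ⟨c, hc⟩ := exists_isGood
    obtain ⟨s, rfl⟩ := exists_cubicSection_eq π L hc t
    exact ⟨s, _, ⟨p, hp, rfl⟩, hpt⟩
  · rintro s ⟨_, ⟨q, hq, rfl⟩, hs⟩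
    exact hU _ ⟨q, hq, hs⟩

end AlgebraicGeometry.Scheme.Modules

end

open AlgebraicGeometry.Scheme.Modules in
theorem mainTheorem5 (X : Scheme.{0}) (π : X ⟶ Spec (.of ℂ)) [IsIntegral X] [IsProper π]
    (L : X.Modules) (hL : L.IsVectorBundle 1) (hgen : L.IsGloballyGenerated) :
    ∃ T : H0 π ((L ⊞ ⨁ fun _ : Fin 5 => structureSheaf X).extPower 3) →
        H0 π (⨁ fun _ : Fin 5 => L),
      HoldsForGeneral (fun s => degeneracyLocus partiallyDecomposable s = zeroLocus 5 (T s)) ∧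
      ∀ P : H0 π (⨁ fun _ : Fin 5 => L) → Prop,
        HoldsForGeneral P → HoldsForGeneral (fun s => P (T s)) := by
  refine ⟨cubicSection π L, ?_, fun P => holdsForGeneral_cubicSection π L⟩
  obtain ⟨U, hU, hne, h⟩ := holdsForGeneral_isGood π L
  exact ⟨U, hU, hne, fun s hs => degeneracyLocus_eq_zeroLocus hL s (h s hs)⟩
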